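/- **Setting.** Let $x_{t+1}=Ax_t+Bu_t+w_t$ with $u_t=-Kx_t$, where $x_0$ and all $w_t$ are square-integrable, $w_t$ has time-independent mean and covariance $W$, and the noise is uncorrelated across time. A set $\mathcal E$ of index pairs defines the linear space of structured gains $\mathcal K=\{K\in\mathbb R^{m\times n}: K_{ab}=0 \text{ for }(a,b)\notin\mathcal E\}$ with the Frobenius norm; $\nabla_{\mathcal K}$ denotes the gradient in the free entries. Let $Q,R,Q_i,R_i$ $(i\in\mathcal I$, $\mathcal I$ finite$)$ be symmetric positive semidefinite, $q_i\in\mathbb R^n$, $c_i\in\mathbb R$, and put $$R_0(K)=\lim_{T\to\infty}\tfrac1T\,\mathbb E\sum_{t<T}(x_t^\top Qx_t+u_t^\top Ru_t),\qquad R_i(K)=\lim_{T\to\infty}\tfrac1T\,\mathbb E\sum_{t<T}(x_t^\top Q_ix_t+u_t^\top R_iu_t+q_i^\top x_t)$$ for stabilizing $K\in\mathcal K$ (spectral radius of $A-BK$ less than one). Here $q_i=0$ for purely quadratic constraints; the linear term covers the mean-variance risk constraint. Fix $\Lambda\ge0$, let $\mathcal Y=[0,\Lambda]^{\mathcal I}$,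 $\mathcal L(K,\lambda)=R_0(K)+\sum_i\lambda_i(R_i(K)-c_i)$, $\Phi(K)=\max_{\lambda\in\mathcal Y}\mathcal L(K,\lambda)$ for stabilizing $K$, and $\Phi(K)=+\infty$ otherwise. For $\ell_0>0$ let $\mu_0=1/(2\ell_0)$ and let $\Phi_{\mu_0}(K)=\inf_{K'\in\mathcal K}\{\Phi(K')+\frac1{2\mu_0}\|K'-K\|^2\}$ be the Moreau envelope. Fix a stabilizing $K^0\in\mathcal K$ and let $\mathcal G^0=\{K\in\mathcal K:\Phi_{\mu_0}(K)\le\Phi_{\mu_0}(K^0)\}$. Numbers $L_0,\ell_0,\rho_0$ are called *constants over $\mathcal G^0$* if every $K\in\mathcal G^0$ is stabilizing and there are positive $L_K,\ell_K,\psi_K,\beta_K$ for $K\in\mathcal G^0$ such that, for all $\lambda\in\mathcal Y$ and $K'\in\mathcal G^0$, $|\mathcal L(K,\lambda)-\mathcal L(K',\lambda)|\le L_K\|K-K'\|$ if $\|K-K'\|\le\psi_K$ and $\|\nabla_{\mathcal K}\mathcal L(K,\lambda)-\nabla_{\mathcal K}\mathcal L(K',\lambda)\|\le\ell_K\|K-K'\|$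 if $\|K-K'\|\le\beta_K$, and $L_0=\sup_{\mathcal G^0}L_K$, $\ell_0=\sup_{\mathcal G^0}\ell_K$, $\rho_0=\inf_{\mathcal G^0}\min\{\beta_K,\psi_K\}$ (the set $\mathcal G^0$ is formed with this same $\ell_0$). **Theorem.** (a) At every stabilizing $K\in\mathcal K$ the limits $R_0(K)$, $R_i(K)$ exist and $\mathcal L(\cdot,\lambda)$ is differentiable for every $\lambda$. (b) If $Q$, $R$ and $W$ are positive definite, then for all sufficiently large $\ell_0$ there are $L_0$ and $\rho_0>0$ such that $L_0,\ell_0,\rho_0$ are constants over $\mathcal G^0$. (c) Let $L_0,\ell_0,\rho_0$ be constants over $\mathcal G^0$, $\epsilon>0$ and $0<\eta\le\min\{\epsilon^2/(4\ell_0L_0^2),\rho_0\}$. Consider gradient descent with max-oracle (GDmax) from $K^0$: at step $j$, choose any $\lambda^j\in\arg\max_{\lambda\in\mathcal Y}\mathcal L(K^j,\lambda)$ and set $K^{j+1}=K^j-\eta\nabla_{\mathcal K}\mathcal L(K^j,\lambda^j)$, as long as no $\epsilon$-stationary point has been reached. Then there is $J$ with $\|\nabla\Phi_{\mu_0}(K^J)\|\le\epsilon$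 (that is, $K^J=K_\epsilon$ is an $\epsilon$-stationary point of $\Phi$) and $$J\le\frac{4\,\Phi_{\mu_0}(K^0)}{\eta\,\epsilon^2},$$ in particular $J\le16\,\ell_0L_0^2\,\Phi_{\mu_0}(K^0)/\epsilon^4=O(\ell_0L_0^2\Phi_{\mu_0}(K^0)/\epsilon^4)$ if $\eta=\epsilon^2/(4\ell_0L_0^2)$. Moreover: - for all $j\le J$, $K^j\in\mathcal G^0$ and $\Phi_{\mu_0}$ is differentiable at $K^j$; and $\Phi_{\mu_0}(K^{j+1})\le\Phi_{\mu_0}(K^j)$ for $j<J$; - if $j\le J$ and $\|\nabla_{\mathcal K}\mathcal L(K^j,\lambda^j)\|\le\epsilon$, then $\|\nabla\Phi_{\mu_0}(K^j)\|\le2\epsilon$; - $K_\epsilon$ yields an $\epsilon$-stationary point of the dual problem $\max_{\lambda\in\mathcal Y}\min_{K\in\mathcal K}\mathcal L(K,\lambda)$: there are a minimizer $\tilde K$ in the definition of $\Phi_{\mu_0}(K_\epsilon)$, with $\tilde K$ stabilizing, and $\tilde\lambda\in\mathcal Y$ with $\|\nabla_{\mathcal K}\mathcal L(\tilde K,\tilde\lambda)\|\le\epsilon$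 and $\|\mathbb P_{\mathcal Y}(\tilde\lambda+\frac1{\ell_0}\nabla_\lambda\mathcal L(\tilde K,\tilde\lambda))-\tilde\lambda\|\le\epsilon/\ell_0$, where $\mathbb P_{\mathcal Y}$ is the Euclidean projection onto $\mathcal Y$. -/

import Mathlib

open Filter Topology MeasureTheory Matrix

noncomputable section

/-- Noise and initial state of the linear system: square-integrable, with a common mean and
covariance of the noise over time, and noise vectors that are uncorrelated across time. -/
structure NoiseModel (n : ℕ) {Ω : Type*} [MeasurableSpace Ω] (ℙ : Measure Ω) where
  /-- initial state -/
  x0 : Ω → Fin n → ℝ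
  /-- noise process -/
  w : ℕ → Ω → Fin n → ℝ
  /-- mean of the noise -/
  wbar : Fin n → ℝ
  /-- covariance of the noise -/
  W : Matrix (Fin n) (Fin n) ℝ
  x0_memLp : ∀ i, MemLp (fun ω => x0 ω i) 2 ℙ
  w_memLp : ∀ t i, MemLp (fun ω => w t ω i) 2 ℙ
  w_mean : ∀ t i, ∫ ω, w t ω i ∂ℙ = wbar i
  w_cov : ∀ t i j, ∫ ω, (w t ω i - wbar i) * (w t ω j - wbar j) ∂ℙ = W i j
  w_uncorr : ∀ s t, s ≠ t → ∀ i j, ∫ ω, (w s ω i - wbar i) * (w t ω j - wbar j) ∂ℙ = 0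

/-- Data of the constrained LQR problem: system matrices `A`, `B`, objective weights `Q`, `R`,
and for every constraint `i` weights `Qc i`, `Rc i`, a linear weight `qc i` (zero for a purely
quadratic constraint, `4 Q M₃` for the mean-variance risk constraint) and a bound `c i`. -/
structure ConstrainedLQR (n m : ℕ) (ι : Type*) where
  A : Matrix (Fin n) (Fin n) ℝ
  B : Matrix (Fin n) (Fin m) ℝ
  Q : Matrix (Fin n) (Fin n) ℝ
  R : Matrix (Fin m) (Fin m) ℝ
  Qc : ι → Matrix (Fin n) (Fin n) ℝ
  Rc : ι → Matrix (Fin m) (Fin m) ℝ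
  qc : ι → Fin n → ℝ
  c : ι → ℝ
  Q_psd : Q.PosSemidef
  R_psd : R.PosSemidef
  Qc_psd : ∀ i, (Qc i).PosSemidef
  Rc_psd : ∀ i, (Rc i).PosSemidef

/-- The structured gains: a gain is given by its entries at the positions in `E`, all other
entries being zero.  The Euclidean norm is the Frobenius norm of the gain matrix. -/
abbrev Gain {n m : ℕ} (E : Finset (Fin m × Fin n)) : Type := EuclideanSpace ℝ E

/-- The gain matrix of a structured gain. -/
def Gain.toMatrix {n m : ℕ} {E : Finset (Fin m × Fin n)} (K : Gain E) :
    Matrix (Fin m) (Fin n) ℝ :=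
  Matrix.of fun a b => if h : (a, b) ∈ E then K ⟨(a, b), h⟩ else 0

/-- The multiplier set `[0, Λ]^ι`. -/
def multiplierBox (ι : Type*) [Fintype ι] (Λ : ℝ) : Set (EuclideanSpace ℝ ι) :=
  {l | ∀ i, 0 ≤ l i ∧ l i ≤ Λ}

/-- The Euclidean projection onto `[0, Λ]^ι`, which acts coordinatewise. -/
def projBox {ι : Type*} [Fintype ι] (Λ : ℝ) (l : EuclideanSpace ℝ ι) : EuclideanSpace ℝ ι :=
  WithLp.toLp 2 fun i => max 0 (min Λ (l i))

namespace ConstrainedLQR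

variable {n m : ℕ} {ι : Type*} [Fintype ι] {Ω : Type*} [MeasurableSpace Ω] {ℙ : Measure Ω}
  {E : Finset (Fin m × Fin n)}

/-- The gain `K` is stabilizing: the powers of the closed-loop matrix `A - B K` tend to zero
(equivalently, its spectral radius is less than one). -/
def Stabilizing (P : ConstrainedLQR n m ι) (K : Gain E) : Prop :=
  Tendsto (fun t : ℕ => (P.A - P.B * K.toMatrix) ^ t) atTop (𝓝 0)

/-- The state trajectory of `x_{t+1} = A x_t + B u_t + w_t` under `u_t = - K x_t`. -/
def state (P : ConstrainedLQR n m ι) (N : NoiseModel n ℙ) (K : Gain E) : ℕ → Ω → Fin n → ℝ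
  | 0 => N.x0
  | t + 1 => fun ω =>
      P.A *ᵥ P.state N K t ω + P.B *ᵥ (-(K.toMatrix *ᵥ P.state N K t ω)) + N.w t ω

/-- The expected cost `(1/T) 𝔼 ∑_{t < T} (xᵀ Q' x + uᵀ R' u + q'ᵀ x)` over a horizon `T`. -/
def runningCost (P : ConstrainedLQR n m ι) (N : NoiseModel n ℙ)
    (Q' : Matrix (Fin n) (Fin n) ℝ) (R' : Matrix (Fin m) (Fin m) ℝ) (q' : Fin n → ℝ)
    (K : Gain E) (T : ℕ) : ℝ :=
  (1 / (T : ℝ)) * ∫ ω, ∑ t ∈ Finset.range T,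
    (P.state N K t ω ⬝ᵥ (Q' *ᵥ P.state N K t ω)
      + (-(K.toMatrix *ᵥ P.state N K t ω)) ⬝ᵥ (R' *ᵥ (-(K.toMatrix *ᵥ P.state N K t ω)))
      + q' ⬝ᵥ P.state N K t ω) ∂ℙ

/-- The objective `R₀(K)`, a limit of running costs (used for stabilizing `K` only). -/
def objective (P : ConstrainedLQR n m ι) (N : NoiseModel n ℙ) (K : Gain E) : ℝ :=
  limUnder atTop (P.runningCost N P.Q P.R 0 K)

/-- The constraint function `R_i(K)`, a limit of running costs (used for stabilizing `K` only). -/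
def constraint (P : ConstrainedLQR n m ι) (N : NoiseModel n ℙ) (i : ι) (K : Gain E) : ℝ :=
  limUnder atTop (P.runningCost N (P.Qc i) (P.Rc i) (P.qc i) K)

/-- The Lagrangian `L(K, λ) = R₀(K) + ∑ i, λ_i (R_i(K) - c_i)`. -/
def lagrangian (P : ConstrainedLQR n m ι) (N : NoiseModel n ℙ) (K : Gain E)
    (l : EuclideanSpace ℝ ι) : ℝ :=
  P.objective N K + ∑ i, l i * (P.constraint N i K - P.c i)

/-- The gradient of `L(·, λ)` with respect to the free entries of the gain. -/
def gradK (P : ConstrainedLQR n m ι) (N : NoiseModel n ℙ) (K : Gain E)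
    (l : EuclideanSpace ℝ ι) : Gain E :=
  gradient (fun K' : Gain E => P.lagrangian N K' l) K

/-- The gradient of `L(K, ·)` with respect to the multiplier. -/
def gradMultiplier (P : ConstrainedLQR n m ι) (N : NoiseModel n ℙ) (K : Gain E)
    (l : EuclideanSpace ℝ ι) : EuclideanSpace ℝ ι :=
  gradient (fun l' : EuclideanSpace ℝ ι => P.lagrangian N K l') l

/-- `Φ(K)`, the maximum of `L(K, λ)` over `λ ∈ [0, Λ]^ι`, for stabilizing `K`. -/
def Phi (P : ConstrainedLQR n m ι) (N : NoiseModel n ℙ) (Λ : ℝ) (K : Gain E) : ℝ :=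
  sSup (P.lagrangian N K '' multiplierBox ι Λ)

/-- The Moreau envelope `Φ_μ` of `Φ` on the structured gains, where `Φ` is understood as `+∞`
at gains that are not stabilizing: these do not enter the infimum. -/
def moreau (P : ConstrainedLQR n m ι) (N : NoiseModel n ℙ) (Λ μ : ℝ) (K : Gain E) : ℝ :=
  sInf ((fun K' : Gain E => P.Phi N Λ K' + 1 / (2 * μ) * ‖K' - K‖ ^ 2) '' {K' | P.Stabilizing K'})

/-- The envelope `Φ_{μ₀}` with `μ₀ = 1 / (2 ℓ₀)`. -/
def envelope (P : ConstrainedLQR n m ι) (N : NoiseModel n ℙ) (Λ ℓ₀ : ℝ) (K : Gain E) : ℝ :=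
  P.moreau N Λ (1 / (2 * ℓ₀)) K

/-- The sublevel set `G⁰ = {K | Φ_{μ₀}(K) ≤ Φ_{μ₀}(K⁰)}`. -/
def sublevel (P : ConstrainedLQR n m ι) (N : NoiseModel n ℙ) (Λ ℓ₀ : ℝ) (K₀ : Gain E) :
    Set (Gain E) :=
  {K | P.envelope N Λ ℓ₀ K ≤ P.envelope N Λ ℓ₀ K₀}

/-- `L₀`, `ℓ₀`, `ρ₀` are constants of the problem over `G⁰`: the Lagrangian is finite on `G⁰`, and
with local Lipschitz constants `L_K` (radius `ψ_K`) and local smoothness constants `ℓ_K`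
(radius `β_K`) at the points `K` of `G⁰`, uniform in `λ ∈ [0, Λ]^ι`, one has `L₀ = sup L_K`,
`ℓ₀ = sup ℓ_K`, and `ρ₀ = inf min {β_K, ψ_K}`. The set `G⁰` depends on `ℓ₀` itself. -/
def IsConstants (P : ConstrainedLQR n m ι) (N : NoiseModel n ℙ) (Λ : ℝ) (K₀ : Gain E)
    (L₀ ℓ₀ ρ₀ : ℝ) : Prop :=
  (∀ K ∈ P.sublevel N Λ ℓ₀ K₀, P.Stabilizing K) ∧
  ∃ Lip smo ψ β : Gain E → ℝ,
    (∀ K ∈ P.sublevel N Λ ℓ₀ K₀, 0 < Lip K ∧ 0 < smo K ∧ 0 < ψ K ∧ 0 < β K ∧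
      ∀ l ∈ multiplierBox ι Λ, ∀ K' ∈ P.sublevel N Λ ℓ₀ K₀,
        (‖K - K'‖ ≤ ψ K → |P.lagrangian N K l - P.lagrangian N K' l| ≤ Lip K * ‖K - K'‖) ∧
        (‖K - K'‖ ≤ β K → ‖P.gradK N K l - P.gradK N K' l‖ ≤ smo K * ‖K - K'‖)) ∧
    IsLUB (Lip '' P.sublevel N Λ ℓ₀ K₀) L₀ ∧
    IsLUB (smo '' P.sublevel N Λ ℓ₀ K₀) ℓ₀ ∧
    IsGLB ((fun K => min (β K) (ψ K)) '' P.sublevel N Λ ℓ₀ K₀) ρ₀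

/-- A run of gradient descent with max-oracle from `K₀` with stepsize `η`: as long as no
`ε`-stationary point of `Φ` has been reached, `λ^j` is a maximizer of `L(K^j, ·)` over
`[0, Λ]^ι` and `K^{j+1} = K^j - η ∇_K L(K^j, λ^j)`. Nothing is asked of the sequences once an
`ε`-stationary point has been reached. -/
structure IsGDmaxRun (P : ConstrainedLQR n m ι) (N : NoiseModel n ℙ) (Λ ℓ₀ η ε : ℝ)
    (K₀ : Gain E) (K : ℕ → Gain E) (l : ℕ → EuclideanSpace ℝ ι) : Prop where
  init : K 0 = K₀
  oracle : ∀ j, (∀ i ≤ j, ε < ‖gradient (P.envelope N Λ ℓ₀) (K i)‖) →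
    l j ∈ multiplierBox ι Λ ∧ IsMaxOn (P.lagrangian N (K j)) (multiplierBox ι Λ) (l j)
  update : ∀ j, (∀ i ≤ j, ε < ‖gradient (P.envelope N Λ ℓ₀) (K i)‖) →
    K (j + 1) = K j - η • P.gradK N (K j) (l j)

/-- `(K, λ)` is an `ε`-stationary point of the Lagrangian, hence of the dual problem
`max_λ min_K L(K, λ)`. -/
def IsDualStationary (P : ConstrainedLQR n m ι) (N : NoiseModel n ℙ) (Λ ℓ₀ ε : ℝ)
    (K : Gain E) (l : EuclideanSpace ℝ ι) : Prop :=
  P.Stabilizing K ∧ l ∈ multiplierBox ι Λ ∧ ‖P.gradK N K l‖ ≤ ε ∧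
    ‖projBox Λ (l + (1 / ℓ₀) • P.gradMultiplier N K l) - l‖ ≤ ε / ℓ₀

/-- `K'` attains the minimum that defines `Φ_{μ₀}(K)`. -/
def IsProx (P : ConstrainedLQR n m ι) (N : NoiseModel n ℙ) (Λ ℓ₀ : ℝ) (K K' : Gain E) : Prop :=
  P.Stabilizing K' ∧ P.envelope N Λ ℓ₀ K = P.Phi N Λ K' + ℓ₀ * ‖K' - K‖ ^ 2

end ConstrainedLQR

end

/-! The function Φ is a maximum of smooth functions, hence weakly convex wherever the gradients of
these functions are Lipschitz, and gradient descent with a max-oracle is analysed through its Moreau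
envelope. The difficulty is that smoothness is known only locally, on a sublevel set G of the
envelope that need not be convex, while Φ is infinite off the stabilizing gains.

What replaces convexity is that, if p is a proximal point of x ∈ G, the closed ball about p through
x lies in G, because p is a competitor in the envelope at each of its points
(`SmoothOnSublevel.mem_of_norm_le`). Every segment on which weak convexity is needed is covered by
such balls. Write d = ‖x - p‖. Danskin's theorem and separation give a maximizer at p whose gradient
is 2ℓ(x - p), so Φ grows by at least (3/2)ℓd² from p to x; the lower quadratic bound at x costs
(1/2)ℓd². Hence the gradient v used by the algorithm satisfies ⟨v, x - p⟩ ≥ ℓd²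
(`le_inner_gradient`). The same growth makes p unique, which yields differentiability of the
envelope with gradient 2ℓ(x - p).

With p as competitor for the next iterate, the envelope changes by at most -2ℓ²ηd² + ℓη²L². Off
ε-stationary points the first term is below -ηε²/2 and the stepsize keeps the second below ηε²/4. So
each step stays in G and lowers the nonnegative envelope by ηε²/4, which bounds the number of steps.
At the end, p and its Danskin multiplier are the dual stationary pair.

The LQR input has two halves. Stationary moments are resolvents of stable linear operators applied
to the noise data, so the costs exist as limits and are C² in the gain. Under positive definiteness
the objective is coercive: bounded cost bounds both the gain and the square sum of the closed-loop
powers. For large ℓ₀ the sets G⁰ therefore lie in one fixed compact set of stabilizing gains, on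
which uniform constants exist. -/

noncomputable section

/-! ### Moreau envelopes: continuity, proximal points, differentiability -/

section Envelope

variable {V : Type*} [NormedAddCommGroup V] [InnerProductSpace ℝ V]

/-- The Moreau envelope, with quadratic weight `ℓ`, of the function that is `Φ` on `S` and `+∞`
elsewhere. -/
def moreauEnvelope (Φ : V → ℝ) (S : Set V) (ℓ : ℝ) (x : V) : ℝ :=
  sInf ((fun y => Φ y + ℓ * ‖y - x‖ ^ 2) '' S)

/-- `p` attains the minimum that defines the Moreau envelope at `x`. -/
def IsProxPoint (Φ : V → ℝ) (S : Set V) (ℓ : ℝ) (x p : V) : Prop :=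
  p ∈ S ∧ moreauEnvelope Φ S ℓ x = Φ p + ℓ * ‖p - x‖ ^ 2

variable {Φ : V → ℝ} {S : Set V} {ℓ : ℝ}

omit [InnerProductSpace ℝ V] in
theorem bddBelow_moreauEnvelope (hΦ : ∀ y ∈ S, 0 ≤ Φ y) (hℓ : 0 < ℓ) (x : V) :
    BddBelow ((fun y => Φ y + ℓ * ‖y - x‖ ^ 2) '' S) := by
  refine ⟨0, ?_⟩
  rintro _ ⟨y, hy, rfl⟩
  have := hΦ y hy
  positivity

omit [InnerProductSpace ℝ V] in
theorem moreauEnvelope_le (hΦ : ∀ y ∈ S, 0 ≤ Φ y) (hℓ : 0 < ℓ) (x : V) {y : V} (hy : y ∈ S) :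
    moreauEnvelope Φ S ℓ x ≤ Φ y + ℓ * ‖y - x‖ ^ 2 :=
  csInf_le (bddBelow_moreauEnvelope hΦ hℓ x) ⟨y, hy, rfl⟩

omit [InnerProductSpace ℝ V] in
theorem le_moreauEnvelope (hS : S.Nonempty) {x : V} {a : ℝ}
    (h : ∀ y ∈ S, a ≤ Φ y + ℓ * ‖y - x‖ ^ 2) : a ≤ moreauEnvelope Φ S ℓ x := by
  refine le_csInf (hS.image _) ?_
  rintro _ ⟨y, hy, rfl⟩
  exact h y hy

omit [InnerProductSpace ℝ V] in
theorem moreauEnvelope_nonneg (hS : S.Nonempty) (hΦ : ∀ y ∈ S, 0 ≤ Φ y) (hℓ : 0 < ℓ) (x : V) :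
    0 ≤ moreauEnvelope Φ S ℓ x :=
  le_moreauEnvelope hS fun y hy => by have := hΦ y hy; positivity

omit [InnerProductSpace ℝ V] in
theorem exists_lt_moreauEnvelope_add (hS : S.Nonempty) (x : V) {δ : ℝ} (hδ : 0 < δ) :
    ∃ y ∈ S, Φ y + ℓ * ‖y - x‖ ^ 2 < moreauEnvelope Φ S ℓ x + δ := by
  obtain ⟨_, ⟨y, hy, rfl⟩, h⟩ := Real.lt_sInf_add_pos (hS.image fun y => Φ y + ℓ * ‖y - x‖ ^ 2) hδ
  exact ⟨y, hy, h⟩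

/-- Expanding the square shows that ℓ‖x‖² minus the envelope is a supremum of functions affine in x.
It is finite and convex, hence continuous in finite dimension, whatever the regularity of Φ. -/
theorem continuous_moreauEnvelope [FiniteDimensional ℝ V] (hS : S.Nonempty)
    (hΦ : ∀ y ∈ S, 0 ≤ Φ y) (hℓ : 0 < ℓ) : Continuous (moreauEnvelope Φ S ℓ) := by
  have hc : ConvexOn ℝ Set.univ fun x => ℓ * ‖x‖ ^ 2 - moreauEnvelope Φ S ℓ x := by
    refine ⟨convex_univ, fun x _ y _ a b ha hb hab => ?_⟩
    have key : a * moreauEnvelope Φ S ℓ x + b * moreauEnvelope Φ S ℓ y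
        - a * (ℓ * ‖x‖ ^ 2) - b * (ℓ * ‖y‖ ^ 2) + ℓ * ‖a • x + b • y‖ ^ 2
        ≤ moreauEnvelope Φ S ℓ (a • x + b • y) := by
      refine le_moreauEnvelope hS fun z hz => ?_
      have h1 := mul_le_mul_of_nonneg_left (moreauEnvelope_le hΦ hℓ x hz) ha
      have h2 := mul_le_mul_of_nonneg_left (moreauEnvelope_le hΦ hℓ y hz) hb
      rw [norm_sub_sq_real] at h1 h2 ⊢
      rw [inner_add_right, inner_smul_right, inner_smul_right]
      have h3 : a = 1 - b := by linarith
      subst h3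
      nlinarith
    simp only [smul_eq_mul]
    linarith
  have h1 : Continuous fun x => ℓ * ‖x‖ ^ 2 - moreauEnvelope Φ S ℓ x := by
    have := hc.continuousOn isOpen_univ
    rwa [← continuousOn_univ]
  have h2 : moreauEnvelope Φ S ℓ = fun x => ℓ * ‖x‖ ^ 2 - (ℓ * ‖x‖ ^ 2 - moreauEnvelope Φ S ℓ x) := by
    ext x; ring
  rw [h2]
  fun_prop

/-- Limit points of minimizing sequences are minimizers if the sublevel set of the envelope
consists of points of the domain. -/
theorem exists_subseq_tendsto_isProxPoint [FiniteDimensional ℝ V] (hΦ : ∀ y ∈ S, 0 ≤ Φ y)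
    (hcont : ∀ y ∈ S, ContinuousAt Φ y) (hℓ : 0 < ℓ) {x : V}
    (hG : ∀ y, moreauEnvelope Φ S ℓ y ≤ moreauEnvelope Φ S ℓ x → y ∈ S)
    {u : ℕ → V} (hu : ∀ k, u k ∈ S)
    (hlim : Tendsto (fun k => Φ (u k) + ℓ * ‖u k - x‖ ^ 2) atTop (𝓝 (moreauEnvelope Φ S ℓ x))) :
    ∃ p, IsProxPoint Φ S ℓ x p ∧ ∃ φ : ℕ → ℕ, StrictMono φ ∧ Tendsto (u ∘ φ) atTop (𝓝 p) := by
  have hS : S.Nonempty := ⟨_, hu 0⟩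
  obtain ⟨M, hM⟩ := hlim.bddAbove_range
  have hbd : Bornology.IsBounded (Set.range u) := by
    -- The radius comes from t ≤ t² + 1, which avoids a square root.
    refine (Metric.isBounded_closedBall (x := x) (r := M / ℓ + 1)).subset ?_
    rintro _ ⟨k, rfl⟩
    have h1 : Φ (u k) + ℓ * ‖u k - x‖ ^ 2 ≤ M := hM ⟨k, rfl⟩
    have h2 := hΦ _ (hu k)
    have h3 : ‖u k - x‖ ^ 2 ≤ M / ℓ := by rw [le_div_iff₀ hℓ]; linarith
    rw [mem_closedBall_iff_norm]
    nlinarith [sq_nonneg (‖u k - x‖ - 1)]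
  obtain ⟨p, -, φ, hφ, hp⟩ := tendsto_subseq_of_bounded hbd fun k => Set.mem_range_self k
  have hlim' := hlim.comp hφ.tendsto_atTop
  -- The envelope is at most Φ on S, so along the sequence it is bounded by values tending to the
  -- envelope at x; by continuity the limit lies in the sublevel set, hence in S.
  have hpS : p ∈ S := by
    refine hG p (le_of_tendsto_of_tendsto'
      ((continuous_moreauEnvelope hS hΦ hℓ).continuousAt.tendsto.comp hp) hlim' fun k => ?_)
    have h1 := moreauEnvelope_le hΦ hℓ (u (φ k)) (hu (φ k))
    simp only [Function.comp_apply, sub_self, norm_zero] at h1 ⊢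
    have : 0 ≤ ℓ * ‖u (φ k) - x‖ ^ 2 := by positivity
    linarith
  refine ⟨p, ⟨hpS, ?_⟩, φ, hφ, hp⟩
  refine tendsto_nhds_unique hlim' ?_
  exact ((hcont p hpS).tendsto.comp hp).add (((hp.sub_const x).norm.pow 2).const_mul ℓ)

theorem exists_isProxPoint [FiniteDimensional ℝ V] (hS : S.Nonempty) (hΦ : ∀ y ∈ S, 0 ≤ Φ y)
    (hcont : ∀ y ∈ S, ContinuousAt Φ y) (hℓ : 0 < ℓ) {x : V}
    (hG : ∀ y, moreauEnvelope Φ S ℓ y ≤ moreauEnvelope Φ S ℓ x → y ∈ S) :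
    ∃ p, IsProxPoint Φ S ℓ x p := by
  have h : ∀ k : ℕ, ∃ y ∈ S, Φ y + ℓ * ‖y - x‖ ^ 2 < moreauEnvelope Φ S ℓ x + 1 / ((k : ℝ) + 1) :=
    fun k => exists_lt_moreauEnvelope_add hS x (by positivity)
  choose u hu hlt using h
  obtain ⟨p, hp, -⟩ := exists_subseq_tendsto_isProxPoint hΦ hcont hℓ hG hu <| by
    refine tendsto_of_tendsto_of_tendsto_of_le_of_le tendsto_const_nhds ?_
      (fun k => moreauEnvelope_le hΦ hℓ x (hu k)) fun k => (hlt k).le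
    simpa using (tendsto_one_div_add_atTop_nhds_zero_nat (𝕜 := ℝ)).const_add (moreauEnvelope Φ S ℓ x)
  exact ⟨p, hp⟩

theorem tendsto_of_unique_isProxPoint [FiniteDimensional ℝ V] (hΦ : ∀ y ∈ S, 0 ≤ Φ y)
    (hcont : ∀ y ∈ S, ContinuousAt Φ y) (hℓ : 0 < ℓ) {x p : V}
    (hG : ∀ y, moreauEnvelope Φ S ℓ y ≤ moreauEnvelope Φ S ℓ x → y ∈ S)
    (huniq : ∀ q, IsProxPoint Φ S ℓ x q → q = p)
    {u : ℕ → V} (hu : ∀ k, u k ∈ S)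
    (hlim : Tendsto (fun k => Φ (u k) + ℓ * ‖u k - x‖ ^ 2) atTop (𝓝 (moreauEnvelope Φ S ℓ x))) :
    Tendsto u atTop (𝓝 p) := by
  refine tendsto_of_subseq_tendsto fun ns hns => ?_
  obtain ⟨q, hq, φ, -, hφ⟩ := exists_subseq_tendsto_isProxPoint hΦ hcont hℓ hG
    (fun k => hu (ns k)) (hlim.comp hns)
  rw [huniq q hq] at hφ
  exact ⟨φ, hφ⟩

omit [InnerProductSpace ℝ V] in
theorem moreauEnvelope_le_of_isProxPoint (hΦ : ∀ y ∈ S, 0 ≤ Φ y) (hℓ : 0 < ℓ) {x p y : V}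
    (hp : IsProxPoint Φ S ℓ x p) (hy : ‖p - y‖ ≤ ‖p - x‖) :
    moreauEnvelope Φ S ℓ y ≤ moreauEnvelope Φ S ℓ x := by
  rw [hp.2]
  refine (moreauEnvelope_le hΦ hℓ y hp.1).trans ?_
  gcongr

/-- Where the proximal point is unique, the Moreau envelope is differentiable. -/
theorem hasGradientAt_moreauEnvelope [FiniteDimensional ℝ V] (hΦ : ∀ y ∈ S, 0 ≤ Φ y)
    (hcont : ∀ y ∈ S, ContinuousAt Φ y) (hℓ : 0 < ℓ) {x p : V}
    (hG : ∀ y, moreauEnvelope Φ S ℓ y ≤ moreauEnvelope Φ S ℓ x → y ∈ S)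
    (hp : IsProxPoint Φ S ℓ x p) (huniq : ∀ q, IsProxPoint Φ S ℓ x q → q = p) :
    HasGradientAt (moreauEnvelope Φ S ℓ) ((2 * ℓ) • (x - p)) x := by
  have hS : S.Nonempty := ⟨p, hp.1⟩
  -- Uniqueness upgrades to stability: near-minimizers at x are close to p, since any minimizing
  -- sequence converges to p.
  have hstab : ∀ ε > 0, ∃ δ > 0, ∀ y ∈ S, Φ y + ℓ * ‖y - x‖ ^ 2 ≤ moreauEnvelope Φ S ℓ x + δ →
      ‖y - p‖ ≤ ε := by
    intro ε hε
    by_contra! hcon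
    have h : ∀ k : ℕ, ∃ y ∈ S,
        Φ y + ℓ * ‖y - x‖ ^ 2 ≤ moreauEnvelope Φ S ℓ x + 1 / ((k : ℝ) + 1) ∧ ε < ‖y - p‖ :=
      fun k => hcon _ (by positivity)
    choose u hu hle hlt using h
    have hconv := tendsto_of_unique_isProxPoint hΦ hcont hℓ hG huniq hu <| by
      refine tendsto_of_tendsto_of_tendsto_of_le_of_le tendsto_const_nhds ?_
        (fun k => moreauEnvelope_le hΦ hℓ x (hu k)) hle
      simpa using
        (tendsto_one_div_add_atTop_nhds_zero_nat (𝕜 := ℝ)).const_add (moreauEnvelope Φ S ℓ x)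
    have h0 : Tendsto (fun k => ‖u k - p‖) atTop (𝓝 0) := by
      simpa using (hconv.sub_const p).norm
    exact absurd (ge_of_tendsto' h0 fun k => (hlt k).le) (not_le.2 hε)
  rw [hasGradientAt_iff_isLittleO, Asymptotics.isLittleO_iff]
  intro c hc
  -- With this radius the inner product error below is at most (c/4)‖y - x‖; the tolerance of the
  -- near-minimizer at y takes another c/4.
  obtain ⟨δ, hδ, hst⟩ := hstab (c / (8 * ℓ)) (by positivity)
  -- bound on near minimizers
  set M := moreauEnvelope Φ S ℓ x with hM
  have hM0 : 0 ≤ M := moreauEnvelope_nonneg hS hΦ hℓ x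
  have hcontE := (continuous_moreauEnvelope hS hΦ hℓ).continuousAt (x := x)
  have e1 : ∀ᶠ y in 𝓝 x, moreauEnvelope Φ S ℓ y < M + min 1 (δ / 4) :=
    hcontE.eventually (gt_mem_nhds (by have : 0 < min 1 (δ / 4) := by positivity
                                       linarith))
  -- D‖y - x‖ bounds the change of the quadratic term of a near-minimizer when its centre moves from
  -- y to x; (M + 2)/ℓ + 1 bounds the distance of that near-minimizer from y.
  set D := 2 * ℓ * ((M + 2) / ℓ + 1) + ℓ with hD
  have hDpos : 0 < D := by positivity
  have e2 : ∀ᶠ y in 𝓝 x, ‖y - x‖ < min (min 1 (δ / (4 * D))) (min (δ / 4) (c / (2 * ℓ))) := by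
    have : Tendsto (fun y => ‖y - x‖) (𝓝 x) (𝓝 0) := by
      have h : Continuous fun y : V => ‖y - x‖ := by fun_prop
      simpa using h.tendsto x
    exact this.eventually (gt_mem_nhds (by positivity))
  filter_upwards [e1, e2] with y hy1 hy2
  simp only [lt_min_iff] at hy2
  obtain ⟨⟨hy3, hy4⟩, hy5, hy6⟩ := hy2
  rw [lt_div_iff₀ (by positivity)] at hy4 hy6
  have hy7 := hy1.trans_le (add_le_add_right (min_le_left _ _) _)
  have hy8 := hy1.trans_le (add_le_add_right (min_le_right _ _) _)
  have hsq : ‖y - x‖ ^ 2 ≤ ‖y - x‖ := by nlinarith [norm_nonneg (y - x)]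
  have hexp : ∀ z : V, ‖z - y‖ ^ 2 = ‖z - x‖ ^ 2 - 2 * inner ℝ (z - x) (y - x) + ‖y - x‖ ^ 2 := by
    intro z
    rw [← norm_sub_sq_real]; congr 2; abel
  have hupper : moreauEnvelope Φ S ℓ y ≤ M + 2 * ℓ * inner ℝ (x - p) (y - x) + ℓ * ‖y - x‖ ^ 2 := by
    refine (moreauEnvelope_le hΦ hℓ y hp.1).trans (le_of_eq ?_)
    rw [hM, hp.2, hexp p, ← neg_sub x p, inner_neg_left]
    rw [norm_neg]; ring
  -- A near-minimizer z at y is also one at x, so it is close to p and may replace p in the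
  -- expansion of the square.
  have hlower : M + 2 * ℓ * inner ℝ (x - p) (y - x) - (c / 2) * ‖y - x‖
      ≤ moreauEnvelope Φ S ℓ y := by
    rcases eq_or_ne y x with rfl | hne
    · simp [hM]
    have hpos : 0 < ‖y - x‖ := norm_pos_iff.2 (sub_ne_zero.2 hne)
    obtain ⟨z, hz, hlt⟩ := exists_lt_moreauEnvelope_add (Φ := Φ) (ℓ := ℓ) hS y
      (δ := c / 4 * ‖y - x‖ ⊓ ‖y - x‖) (by positivity)
    have hlt1 := hlt.trans_le (add_le_add_right inf_le_left _)
    have hlt2 := hlt.trans_le (add_le_add_right inf_le_right _)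
    have hz0 := hΦ z hz
    have hzy : ‖z - y‖ ^ 2 ≤ (M + 2) / ℓ := by
      rw [le_div_iff₀ hℓ]; linarith
    have hzy' : ‖z - y‖ ≤ (M + 2) / ℓ + 1 := by nlinarith [sq_nonneg (‖z - y‖ - 1)]
    have hzx : ‖z - x‖ ≤ ‖z - y‖ + ‖y - x‖ := by
      simpa using norm_add_le (z - y) (y - x)
    have hzx2 : ‖z - x‖ ^ 2 ≤ ‖z - y‖ ^ 2 + 2 * ‖z - y‖ * ‖y - x‖ + ‖y - x‖ ^ 2 := by
      nlinarith [norm_nonneg (z - x), norm_nonneg (z - y)]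
    have hnear : Φ z + ℓ * ‖z - x‖ ^ 2 ≤ M + δ := by
      have h1 : ‖z - y‖ * ‖y - x‖ ≤ ((M + 2) / ℓ + 1) * ‖y - x‖ := by gcongr
      have h2 : ℓ * ‖z - x‖ ^ 2 ≤ ℓ * ‖z - y‖ ^ 2 + D * ‖y - x‖ := by
        calc ℓ * ‖z - x‖ ^ 2 ≤ ℓ * (‖z - y‖ ^ 2 + 2 * ‖z - y‖ * ‖y - x‖ + ‖y - x‖ ^ 2) := by gcongr
          _ = ℓ * ‖z - y‖ ^ 2 + 2 * ℓ * (‖z - y‖ * ‖y - x‖) + ℓ * ‖y - x‖ ^ 2 := by ring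
          _ ≤ ℓ * ‖z - y‖ ^ 2 + 2 * ℓ * (((M + 2) / ℓ + 1) * ‖y - x‖) + ℓ * ‖y - x‖ := by gcongr
          _ = _ := by rw [hD]; ring
      nlinarith
    have hzp := hst z hz hnear
    have hle := moreauEnvelope_le hΦ hℓ x hz
    have hin : inner ℝ (z - p) (y - x) ≤ c / (8 * ℓ) * ‖y - x‖ :=
      (real_inner_le_norm _ _).trans (by gcongr)
    have hin2 : inner ℝ (z - x) (y - x) = inner ℝ (z - p) (y - x) - inner ℝ (x - p) (y - x) := by
      rw [← inner_sub_left]; congr 1; abel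
    have h9 : 2 * ℓ * inner ℝ (z - p) (y - x) ≤ c / 4 * ‖y - x‖ := by
      calc 2 * ℓ * inner ℝ (z - p) (y - x) ≤ 2 * ℓ * (c / (8 * ℓ) * ‖y - x‖) := by gcongr
        _ = _ := by field_simp; ring
    rw [hexp z, hin2] at hlt1
    have : 0 ≤ ℓ * ‖y - x‖ ^ 2 := by positivity
    nlinarith
  rw [inner_smul_left, Real.norm_eq_abs, abs_le]
  simp only [conj_trivial]
  have h10 : ℓ * ‖y - x‖ ^ 2 ≤ c * ‖y - x‖ := by nlinarith [norm_nonneg (y - x)]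
  have h11 : 0 ≤ c * ‖y - x‖ := by positivity
  constructor <;> linarith

end Envelope

/-! ### Maxima of Lagrangians and first-order optimality -/

section MaxFunction

variable {V : Type*} [NormedAddCommGroup V] [InnerProductSpace ℝ V] {ι : Type*} [Fintype ι]

/-- A function of `x` and `l` that is affine in `l`, as a Lagrangian is. -/
def affineLagrangian (f₀ : V → ℝ) (f : ι → V → ℝ) (x : V) (l : EuclideanSpace ℝ ι) : ℝ :=
  f₀ x + ∑ i, l i * f i x

/-- The maximum over `l ∈ B` of a function that is affine in `l`. -/
def maxValue (f₀ : V → ℝ) (f : ι → V → ℝ) (B : Set (EuclideanSpace ℝ ι)) (x : V) : ℝ :=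
  sSup (affineLagrangian f₀ f x '' B)

variable {f₀ : V → ℝ} {f : ι → V → ℝ} {B : Set (EuclideanSpace ℝ ι)}

omit [NormedAddCommGroup V] [InnerProductSpace ℝ V] in
theorem continuous_affineLagrangian (x : V) : Continuous (affineLagrangian f₀ f x) := by
  unfold affineLagrangian
  fun_prop

omit [NormedAddCommGroup V] [InnerProductSpace ℝ V] in
theorem affineLagrangian_le_maxValue (hB : IsCompact B) (x : V) {l : EuclideanSpace ℝ ι}
    (hl : l ∈ B) : affineLagrangian f₀ f x l ≤ maxValue f₀ f B x :=
  le_csSup (hB.image (continuous_affineLagrangian x)).bddAbove ⟨l, hl, rfl⟩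

omit [NormedAddCommGroup V] [InnerProductSpace ℝ V] in
theorem maxValue_eq_of_isMaxOn {x : V} {l : EuclideanSpace ℝ ι} (hl : l ∈ B)
    (hmax : IsMaxOn (affineLagrangian f₀ f x) B l) : maxValue f₀ f B x = affineLagrangian f₀ f x l :=
  IsGreatest.csSup_eq ⟨⟨l, hl, rfl⟩, by rintro _ ⟨l', hl', rfl⟩; exact hmax hl'⟩

omit [NormedAddCommGroup V] [InnerProductSpace ℝ V] in
theorem exists_isMaxOn_affineLagrangian (hB : IsCompact B) (hne : B.Nonempty) (x : V) :
    ∃ l ∈ B, IsMaxOn (affineLagrangian f₀ f x) B l :=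
  hB.exists_isMaxOn hne (continuous_affineLagrangian x).continuousOn

omit [InnerProductSpace ℝ V] in
theorem continuousAt_maxValue (hB : IsCompact B) {x : V} (h₀ : ContinuousAt f₀ x)
    (h : ∀ i, ContinuousAt (f i) x) : ContinuousAt (maxValue f₀ f B) x := by
  have hc : Continuous fun a : ℝ × (ι → ℝ) =>
      sSup ((fun l : EuclideanSpace ℝ ι => a.1 + ∑ i, l i * a.2 i) '' B) :=
    hB.continuous_sSup (by simp only [Function.HasUncurry.uncurry, id]; fun_prop)
  exact hc.continuousAt.comp (f := fun y => (f₀ y, fun i => f i y))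
    (h₀.prodMk (continuousAt_pi.2 h))

theorem hasGradientAt_affineLagrangian [CompleteSpace V] {x : V} {g₀ : V} {g : ι → V}
    (h₀ : HasGradientAt f₀ g₀ x) (h : ∀ i, HasGradientAt (f i) (g i) x) (l : EuclideanSpace ℝ ι) :
    HasGradientAt (fun y => affineLagrangian f₀ f y l) (g₀ + ∑ i, l i • g i) x := by
  rw [hasGradientAt_iff_hasFDerivAt] at h₀ ⊢
  simp only [hasGradientAt_iff_hasFDerivAt] at h
  have := h₀.fun_add (HasFDerivAt.fun_sum (u := Finset.univ) fun i _ => (h i).const_mul (l i))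
  simpa [affineLagrangian] using this

theorem HasGradientAt.tendsto_slope [CompleteSpace V] {φ : V → ℝ} {x g h : V}
    (hφ : HasGradientAt φ g x) {s : ℕ → ℝ} (hs : Tendsto s atTop (𝓝[≠] 0)) :
    Tendsto (fun k => (s k)⁻¹ * (φ (x + s k • h) - φ x)) atTop (𝓝 (inner ℝ g h)) := by
  have hd : HasDerivAt (fun t : ℝ => φ (x + t • h)) (inner ℝ g h) 0 := by
    have h1 : HasDerivAt (fun t : ℝ => x + t • h) h 0 := by
      simpa using ((hasDerivAt_id (0 : ℝ)).smul_const h).const_add x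
    have h2 := hφ.hasFDerivAt
    have h3 : x = x + (0 : ℝ) • h := by simp
    rw [h3] at h2
    simpa [Function.comp_def] using h2.comp_hasDerivAt (0 : ℝ) h1
  have := (hasDerivAt_iff_tendsto_slope.1 hd).comp hs
  refine this.congr fun k => ?_
  simp [slope_def_field, div_eq_inv_mul]

/-- First-order optimality of a proximal point of a maximum of functions (Danskin): the gradient
of one of the maximizing functions balances that of the quadratic term. -/
theorem IsProxPoint.exists_isMaxOn_gradient_eq [FiniteDimensional ℝ V] {S : Set V} {ℓ : ℝ}
    (hS : IsOpen S) (hB : IsCompact B) (hBne : B.Nonempty) (hBc : Convex ℝ B)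
    (hΦ : ∀ y ∈ S, 0 ≤ maxValue f₀ f B y) (hℓ : 0 < ℓ)
    {x p : V} (hp : IsProxPoint (maxValue f₀ f B) S ℓ x p) {g₀ : V} {g : ι → V}
    (h₀ : HasGradientAt f₀ g₀ p) (h : ∀ i, HasGradientAt (f i) (g i) p) :
    ∃ l ∈ B, IsMaxOn (affineLagrangian f₀ f p) B l ∧
      g₀ + ∑ i, l i • g i = (2 * ℓ) • (x - p) := by
  set c : EuclideanSpace ℝ ι → V := fun l => g₀ + ∑ i, l i • g i - (2 * ℓ) • (x - p) with hc
  set A : Set (EuclideanSpace ℝ ι) := {l ∈ B | IsMaxOn (affineLagrangian f₀ f p) B l} with hA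
  have hAeq : A = B ∩ {l | maxValue f₀ f B p ≤ affineLagrangian f₀ f p l} := by
    ext l
    constructor
    · rintro ⟨hl, hmax⟩
      exact ⟨hl, (maxValue_eq_of_isMaxOn hl hmax).le⟩
    · rintro ⟨hl, hle⟩
      exact ⟨hl, fun l' hl' => (affineLagrangian_le_maxValue hB p hl').trans hle⟩
  have hAcomp : IsCompact A := by
    rw [hAeq]
    exact hB.inter_right (isClosed_le continuous_const (continuous_affineLagrangian p))
  have hAconv : Convex ℝ A := by
    rw [hAeq]
    refine hBc.inter fun l hl l' hl' a b ha hb hab => ?_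
    simp only [Set.mem_ofPred_eq] at hl hl' ⊢
    have e : affineLagrangian f₀ f p (a • l + b • l')
        = a * affineLagrangian f₀ f p l + b * affineLagrangian f₀ f p l' := by
      simp only [affineLagrangian, PiLp.add_apply, PiLp.smul_apply, smul_eq_mul, mul_add,
        Finset.mul_sum, add_mul, Finset.sum_add_distrib, mul_assoc]
      have : a = 1 - b := by linarith
      subst this
      ring
    rw [e]
    have h1 := mul_le_mul_of_nonneg_left hl ha
    have h2 := mul_le_mul_of_nonneg_left hl' hb
    have : a * maxValue f₀ f B p + b * maxValue f₀ f B p = maxValue f₀ f B p := by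
      rw [← add_mul, hab, one_mul]
    linarith
  have hccont : Continuous c := by fun_prop
  have hCconv : Convex ℝ (c '' A) := by
    rintro _ ⟨l, hl, rfl⟩ _ ⟨l', hl', rfl⟩ a b ha hb hab
    refine ⟨a • l + b • l', hAconv hl hl' ha hb hab, ?_⟩
    have : a = 1 - b := by linarith
    subst this
    simp only [hc, PiLp.add_apply, PiLp.smul_apply, smul_eq_mul, add_smul, mul_smul,
      Finset.sum_add_distrib, ← Finset.smul_sum]
    module
  -- The claim is that 0 belongs to the compact convex set of gradient residuals of maximizers at p.
  -- Otherwise a separating hyperplane gives a direction d of strict descent for all of them at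
  -- once.
  by_cases h0 : (0 : V) ∈ c '' A
  · obtain ⟨l, ⟨hl, hmax⟩, hcl⟩ := h0
    exact ⟨l, hl, hmax, sub_eq_zero.1 hcl⟩
  exfalso
  obtain ⟨F, u, hFu, hu⟩ := geometric_hahn_banach_closed_point hCconv
    (hAcomp.image hccont).isClosed h0
  rw [map_zero] at hu
  set d : V := (InnerProductSpace.toDual ℝ V).symm F with hd
  have hFd : ∀ v, F v = inner ℝ v d := fun v => by
    rw [real_inner_comm, hd, InnerProductSpace.toDual_symm_apply]
  have hneg : ∀ l ∈ A, inner ℝ (c l) d < 0 := fun l hl => by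
    rw [← hFd]; exact (hFu _ ⟨l, hl, rfl⟩).trans hu
  -- move from `p` in the direction `d`
  set s : ℕ → ℝ := fun k => 1 / ((k : ℝ) + 1) with hs
  have hspos : ∀ k, 0 < s k := fun k => by simp only [hs]; positivity
  have hs0 : Tendsto s atTop (𝓝 0) := tendsto_one_div_add_atTop_nhds_zero_nat
  have hs0' : Tendsto s atTop (𝓝[≠] 0) :=
    tendsto_nhdsWithin_iff.2 ⟨hs0, Eventually.of_forall fun k => (hspos k).ne'⟩
  have hpk : Tendsto (fun k => p + s k • d) atTop (𝓝 p) := by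
    simpa using (hs0.smul_const d).const_add p
  choose lam hlamB hlam using fun k =>
    exists_isMaxOn_affineLagrangian (f₀ := f₀) (f := f) hB hBne (p + s k • d)
  obtain ⟨l, hlB, φ, hφ, hlim⟩ := hB.tendsto_subseq hlamB
  have hlimi : ∀ i, Tendsto (fun k => lam (φ k) i) atTop (𝓝 (l i)) := fun i =>
    ((EuclideanSpace.proj i : EuclideanSpace ℝ ι →L[ℝ] ℝ).continuous.tendsto l).comp hlim
  have hpφ := hpk.comp hφ.tendsto_atTop
  have hlA : l ∈ A := by
    refine ⟨hlB, fun l' hl' => ?_⟩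
    have t1 : Tendsto (fun k => affineLagrangian f₀ f (p + s (φ k) • d) l') atTop
        (𝓝 (affineLagrangian f₀ f p l')) :=
      (h₀.continuousAt.tendsto.comp hpφ).add
        (tendsto_finsetSum _ fun i _ => ((h i).continuousAt.tendsto.comp hpφ).const_mul _)
    have t2 : Tendsto (fun k => affineLagrangian f₀ f (p + s (φ k) • d) (lam (φ k))) atTop
        (𝓝 (affineLagrangian f₀ f p l)) :=
      (h₀.continuousAt.tendsto.comp hpφ).add
        (tendsto_finsetSum _ fun i _ => (hlimi i).mul ((h i).continuousAt.tendsto.comp hpφ))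
    exact le_of_tendsto_of_tendsto' t1 t2 fun k => hlam (φ k) hl'
  -- Minimality of p bounds the increment of the objective below. Using the maximizer at the
  -- displaced point for both values, exact there and only a lower bound at p, turns it into
  -- difference quotients of the smooth pieces. Their limit contradicts strict descent at l.
  have hineq : ∀ᶠ k in atTop, 0 ≤ (s (φ k))⁻¹ * (f₀ (p + s (φ k) • d) - f₀ p)
      + ∑ i, lam (φ k) i * ((s (φ k))⁻¹ * (f i (p + s (φ k) • d) - f i p))
      + ℓ * (2 * inner ℝ (p - x) d + s (φ k) * ‖d‖ ^ 2) := by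
    filter_upwards [hpφ.eventually (hS.mem_nhds hp.1)] with k hk
    have e1 := moreauEnvelope_le hΦ hℓ x hk
    rw [hp.2, Function.comp_apply, maxValue_eq_of_isMaxOn (hlamB (φ k)) (hlam (φ k))] at e1
    have e2 := affineLagrangian_le_maxValue (f₀ := f₀) (f := f) hB p (hlamB (φ k))
    have e3 : ‖p + s (φ k) • d - x‖ ^ 2
        = ‖p - x‖ ^ 2 + s (φ k) * (2 * inner ℝ (p - x) d + s (φ k) * ‖d‖ ^ 2) := by
      rw [add_sub_right_comm, norm_add_sq_real, inner_smul_right, norm_smul, mul_pow,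
        Real.norm_eq_abs, sq_abs]
      ring
    rw [e3] at e1
    have e4 : 0 ≤ s (φ k) * ((s (φ k))⁻¹ * (f₀ (p + s (φ k) • d) - f₀ p)
      + ∑ i, lam (φ k) i * ((s (φ k))⁻¹ * (f i (p + s (φ k) • d) - f i p))
      + ℓ * (2 * inner ℝ (p - x) d + s (φ k) * ‖d‖ ^ 2)) := by
      have e5 : s (φ k) * ∑ i, lam (φ k) i * ((s (φ k))⁻¹ * (f i (p + s (φ k) • d) - f i p))
          = ∑ i, lam (φ k) i * f i (p + s (φ k) • d) - ∑ i, lam (φ k) i * f i p := by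
        rw [Finset.mul_sum, ← Finset.sum_sub_distrib]
        refine Finset.sum_congr rfl fun i _ => ?_
        field_simp [(hspos (φ k)).ne']
      rw [mul_add, mul_add, e5, mul_inv_cancel_left₀ (hspos (φ k)).ne']
      simp only [affineLagrangian] at e1 e2
      linarith
    exact nonneg_of_mul_nonneg_right e4 (hspos (φ k))
  have hsφ := hs0'.comp hφ.tendsto_atTop
  have hlimit := ((h₀.tendsto_slope (h := d) hsφ).add (tendsto_finsetSum Finset.univ fun i _ =>
    (hlimi i).mul ((h i).tendsto_slope (h := d) hsφ))).add
    ((((hs0.comp hφ.tendsto_atTop).mul_const (‖d‖ ^ 2)).const_add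
      (2 * inner ℝ (p - x) d)).const_mul ℓ)
  have hge := ge_of_tendsto hlimit hineq
  have hlt := hneg l hlA
  simp only [hc, inner_sub_left, inner_add_left, sum_inner, inner_smul_left, conj_trivial] at hlt
  simp only [inner_sub_left] at hge
  linarith

end MaxFunction

/-! ### Weak convexity on a sublevel set and the descent estimate -/

section WeaklyConvex

variable {V : Type*} [NormedAddCommGroup V] [InnerProductSpace ℝ V]

omit [InnerProductSpace ℝ V] in
/-- A map that is Lipschitz on pairs of nearby points of a segment is Lipschitz along it. -/
theorem norm_sub_le_of_local_lipschitz_segment [NormedSpace ℝ V] {g : V → V} {ℓ ρ : ℝ} (hρ : 0 < ρ)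
    {x y : V} (hg : ∀ z ∈ segment ℝ x y, ∀ w ∈ segment ℝ x y, ‖z - w‖ ≤ ρ →
      ‖g z - g w‖ ≤ ℓ * ‖z - w‖) {t : ℝ} (ht : t ∈ Set.Icc (0 : ℝ) 1) :
    ‖g (x + t • (y - x)) - g x‖ ≤ ℓ * (t * ‖y - x‖) := by
  -- Cut the segment into N pieces no longer than ρ and add up the local bounds.
  obtain ⟨N, hN⟩ := exists_nat_gt (‖y - x‖ / ρ)
  have hN0 : (0 : ℝ) < N := lt_of_le_of_lt (by positivity) hN
  rw [div_lt_iff₀ hρ] at hN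
  set z : ℕ → V := fun k => x + (t * (k / N)) • (y - x) with hz
  have hmem : ∀ k ≤ N, z k ∈ segment ℝ x y := by
    intro k hk
    have hk' : (k : ℝ) / N ≤ 1 := by
      rw [div_le_one hN0]; exact_mod_cast hk
    rw [segment_eq_image']
    exact ⟨_, ⟨mul_nonneg ht.1 (by positivity), mul_le_one₀ ht.2 (by positivity) hk'⟩, rfl⟩
  have hstep : ∀ k, ‖z k - z (k + 1)‖ = t / N * ‖y - x‖ := by
    intro k
    have : z k - z (k + 1) = -((t / N) • (y - x)) := by
      simp only [hz]
      push_cast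
      rw [add_sub_add_left_eq_sub, ← sub_smul, ← neg_smul]
      congr 1
      field_simp
      ring
    rw [this, norm_neg, norm_smul, Real.norm_of_nonneg (div_nonneg ht.1 hN0.le)]
  have hd : dist (g (z 0)) (g (z N)) ≤ ∑ k ∈ Finset.range N, ℓ * (t / N * ‖y - x‖) := by
    refine dist_le_range_sum_of_dist_le (f := fun k => g (z k)) N fun {k} hk => ?_
    rw [dist_eq_norm, ← hstep k]
    refine hg _ (hmem k hk.le) _ (hmem (k + 1) hk) ?_
    rw [hstep, div_mul_eq_mul_div, div_le_iff₀ hN0]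
    calc t * ‖y - x‖ ≤ 1 * ‖y - x‖ := by gcongr; exact ht.2
      _ ≤ ρ * N := by linarith
  have hz0 : z 0 = x := by simp [hz]
  have hzN : z N = x + t • (y - x) := by simp [hz, hN0.ne']
  rw [hz0, hzN, Finset.sum_const, Finset.card_range, nsmul_eq_mul, dist_comm, dist_eq_norm] at hd
  refine hd.trans (le_of_eq ?_)
  field_simp

/-- A function whose gradient is Lipschitz with constant `ℓ` at nearby points of a segment is
bounded below on it by a quadratic function. -/
theorem quadratic_lower_bound_of_segment [CompleteSpace V] {φ : V → ℝ} {g : V → V} {ℓ ρ : ℝ}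
    (hρ : 0 < ρ) {x y : V} (hφ : ∀ z ∈ segment ℝ x y, HasGradientAt φ (g z) z)
    (hg : ∀ z ∈ segment ℝ x y, ∀ w ∈ segment ℝ x y, ‖z - w‖ ≤ ρ →
      ‖g z - g w‖ ≤ ℓ * ‖z - w‖) :
    φ x + inner ℝ (g x) (y - x) - ℓ / 2 * ‖y - x‖ ^ 2 ≤ φ y := by
  -- The defect of the quadratic bound along the segment; the Lipschitz estimate makes its
  -- derivative nonnegative, and the claim is h 0 ≤ h 1.
  set h : ℝ → ℝ := fun t =>
    φ (x + t • (y - x)) - t * inner ℝ (g x) (y - x) + ℓ / 2 * ‖y - x‖ ^ 2 * t ^ 2 with hh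
  have hder : ∀ t ∈ Set.Icc (0 : ℝ) 1, HasDerivAt h
      (inner ℝ (g (x + t • (y - x))) (y - x) - inner ℝ (g x) (y - x) + ℓ * ‖y - x‖ ^ 2 * t) t := by
    intro t ht
    have h1 : HasDerivAt (fun t : ℝ => x + t • (y - x)) (y - x) t := by
      simpa using ((hasDerivAt_id t).smul_const (y - x)).const_add x
    have h2 := (hφ (x + t • (y - x)) (by rw [segment_eq_image']; exact ⟨t, ht, rfl⟩)).hasFDerivAt
    have h3 := h2.comp_hasDerivAt t h1
    have h4 := (h3.sub ((hasDerivAt_id t).mul_const (inner ℝ (g x) (y - x)))).add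
      ((hasDerivAt_pow 2 t).const_mul (ℓ / 2 * ‖y - x‖ ^ 2))
    refine h4.congr_deriv ?_
    simp
    ring
  have hmono : MonotoneOn h (Set.Icc 0 1) := by
    refine monotoneOn_of_deriv_nonneg (convex_Icc 0 1)
      (fun t ht => (hder t ht).continuousAt.continuousWithinAt)
      (fun t ht => (hder t (interior_subset ht)).differentiableAt.differentiableWithinAt) ?_
    intro t ht
    have ht' := interior_subset ht
    rw [(hder t ht').deriv, ← inner_sub_left]
    have h5 := norm_sub_le_of_local_lipschitz_segment hρ hg ht'
    have h6 := (abs_le.1 (abs_real_inner_le_norm (g (x + t • (y - x)) - g x) (y - x))).1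
    have h7 : ‖g (x + t • (y - x)) - g x‖ * ‖y - x‖ ≤ ℓ * (t * ‖y - x‖) * ‖y - x‖ := by gcongr
    nlinarith
  have := hmono (Set.left_mem_Icc.2 zero_le_one) (Set.right_mem_Icc.2 zero_le_one) zero_le_one
  simp only [hh] at this
  simp at this
  linarith

variable {ι : Type*} [Fintype ι] {f₀ : V → ℝ} {f : ι → V → ℝ} {B : Set (EuclideanSpace ℝ ι)}
  {S G : Set V} {ℓ ρ : ℝ}

theorem hasGradientAt_affineLagrangian_gradient [CompleteSpace V] {x : V}
    (h₀ : DifferentiableAt ℝ f₀ x) (h : ∀ i, DifferentiableAt ℝ (f i) x)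
    (l : EuclideanSpace ℝ ι) :
    HasGradientAt (fun y => affineLagrangian f₀ f y l)
      (gradient (fun y => affineLagrangian f₀ f y l) x) x :=
  (hasGradientAt_affineLagrangian h₀.hasGradientAt
    (fun i => (h i).hasGradientAt) l).differentiableAt.hasGradientAt

/-- A maximum of smooth functions over a compact convex multiplier set, with a sublevel set `G` of
its Moreau envelope on which the gradients are locally Lipschitz with constant `ℓ`. -/
structure SmoothOnSublevel (f₀ : V → ℝ) (f : ι → V → ℝ) (B : Set (EuclideanSpace ℝ ι))
    (S G : Set V) (ℓ ρ : ℝ) [CompleteSpace V] : Prop where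
  isOpen : IsOpen S
  isCompact : IsCompact B
  nonempty : B.Nonempty
  convex : Convex ℝ B
  nonneg : ∀ y ∈ S, 0 ≤ maxValue f₀ f B y
  diff₀ : ∀ y ∈ S, DifferentiableAt ℝ f₀ y
  diff : ∀ y ∈ S, ∀ i, DifferentiableAt ℝ (f i) y
  pos : 0 < ℓ
  radius_pos : 0 < ρ
  subset : G ⊆ S
  lower : ∀ x ∈ G, ∀ y, moreauEnvelope (maxValue f₀ f B) S ℓ y ≤
    moreauEnvelope (maxValue f₀ f B) S ℓ x → y ∈ G
  smooth : ∀ x ∈ G, ∀ y ∈ G, ∀ l ∈ B, ‖x - y‖ ≤ ρ →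
    ‖gradient (fun z => affineLagrangian f₀ f z l) x -
      gradient (fun z => affineLagrangian f₀ f z l) y‖ ≤ ℓ * ‖x - y‖

namespace SmoothOnSublevel

variable [FiniteDimensional ℝ V]

theorem continuousAt (H : SmoothOnSublevel f₀ f B S G ℓ ρ) :
    ∀ y ∈ S, ContinuousAt (maxValue f₀ f B) y := fun y hy =>
  continuousAt_maxValue H.isCompact (H.diff₀ y hy).continuousAt
    fun i => (H.diff y hy i).continuousAt

/-- Substitute for convexity of G: the point p is a competitor for y with quadratic term no larger
than for x, so the ball about p through x stays in G. -/
theorem mem_of_norm_le (H : SmoothOnSublevel f₀ f B S G ℓ ρ) {x p y : V} (hx : x ∈ G)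
    (hp : IsProxPoint (maxValue f₀ f B) S ℓ x p) (hy : ‖p - y‖ ≤ ‖p - x‖) : y ∈ G :=
  H.lower x hx y (moreauEnvelope_le_of_isProxPoint H.nonneg H.pos hp hy)

theorem lower_bound (H : SmoothOnSublevel f₀ f B S G ℓ ρ) {x y : V}
    (hxy : segment ℝ x y ⊆ G) {l : EuclideanSpace ℝ ι} (hl : l ∈ B) :
    affineLagrangian f₀ f x l + inner ℝ (gradient (fun z => affineLagrangian f₀ f z l) x) (y - x)
      - ℓ / 2 * ‖y - x‖ ^ 2 ≤ affineLagrangian f₀ f y l :=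
  quadratic_lower_bound_of_segment (φ := fun z => affineLagrangian f₀ f z l)
    (g := gradient fun z => affineLagrangian f₀ f z l) H.radius_pos
    (fun z hz => hasGradientAt_affineLagrangian_gradient (H.diff₀ z (H.subset (hxy hz)))
      (H.diff z (H.subset (hxy hz))) l)
    fun z hz w hw h => H.smooth z (hxy hz) w (hxy hw) l hl h

theorem exists_isMaxOn_gradient_eq (H : SmoothOnSublevel f₀ f B S G ℓ ρ) {x p : V}
    (hp : IsProxPoint (maxValue f₀ f B) S ℓ x p) :
    ∃ l ∈ B, IsMaxOn (affineLagrangian f₀ f p) B l ∧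
      gradient (fun z => affineLagrangian f₀ f z l) p = (2 * ℓ) • (x - p) := by
  obtain ⟨l, hl, hmax, he⟩ := hp.exists_isMaxOn_gradient_eq H.isOpen H.isCompact H.nonempty
    H.convex H.nonneg H.pos (H.diff₀ p hp.1).hasGradientAt fun i => (H.diff p hp.1 i).hasGradientAt
  refine ⟨l, hl, hmax, ?_⟩
  rw [← he]
  exact (hasGradientAt_affineLagrangian (H.diff₀ p hp.1).hasGradientAt
    (fun i => (H.diff p hp.1 i).hasGradientAt) l).gradient

/-- Growth of the maximum function away from a proximal point. -/
theorem maxValue_growth (H : SmoothOnSublevel f₀ f B S G ℓ ρ) {x p y : V}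
    (hp : IsProxPoint (maxValue f₀ f B) S ℓ x p) (hseg : segment ℝ p y ⊆ G) :
    maxValue f₀ f B p + 2 * ℓ * inner ℝ (x - p) (y - p) - ℓ / 2 * ‖y - p‖ ^ 2
      ≤ maxValue f₀ f B y := by
  obtain ⟨l, hl, hmax, he⟩ := H.exists_isMaxOn_gradient_eq hp
  have h1 := H.lower_bound hseg hl
  rw [he, inner_smul_left, conj_trivial] at h1
  rw [maxValue_eq_of_isMaxOn hl hmax]
  exact h1.trans (affineLagrangian_le_maxValue H.isCompact y hl)

/-- The balls about p and q through x both contain x, so together they cover the segment from p to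
q, and the growth estimate at p applies at q. There the curvature 2ℓ of the proximal term beats the
weak convexity ℓ. -/
theorem prox_unique (H : SmoothOnSublevel f₀ f B S G ℓ ρ) {x p q : V} (hx : x ∈ G)
    (hp : IsProxPoint (maxValue f₀ f B) S ℓ x p) (hq : IsProxPoint (maxValue f₀ f B) S ℓ x q) :
    q = p := by
  have hseg : segment ℝ p q ⊆ G := by
    intro z hz
    by_contra hcon
    have h1 : ‖p - x‖ < ‖p - z‖ := lt_of_not_ge fun h => hcon (H.mem_of_norm_le hx hp h)
    have h2 : ‖q - x‖ < ‖q - z‖ := lt_of_not_ge fun h => hcon (H.mem_of_norm_le hx hq h)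
    have h3 : ‖p - z‖ + ‖z - q‖ = ‖p - q‖ := by
      simpa [dist_eq_norm] using dist_add_dist_of_mem_segment hz
    have h4 : ‖p - q‖ ≤ ‖p - x‖ + ‖x - q‖ := by simpa using norm_add_le (p - x) (x - q)
    rw [norm_sub_rev z q] at h3
    rw [norm_sub_rev x q] at h4
    linarith
  have h1 := H.maxValue_growth hp hseg
  have h2 := hp.2.symm.trans hq.2
  have h3 : ‖q - x‖ ^ 2 = ‖q - p‖ ^ 2 - 2 * inner ℝ (x - p) (q - p) + ‖p - x‖ ^ 2 := by
    have : q - x = (q - p) - (x - p) := by abel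
    rw [this, norm_sub_sq_real, real_inner_comm, norm_sub_rev x p]
  rw [h3] at h2
  -- Equal proximal values force Φ(q) = Φ(p) + 2ℓ⟨x - p, q - p⟩ - ℓ‖q - p‖², whereas growth only
  -- allows a loss of (ℓ/2)‖q - p‖².
  have h4 : ‖q - p‖ ^ 2 ≤ 0 := by
    have := H.pos
    nlinarith
  have h5 : ‖q - p‖ = 0 := pow_eq_zero_iff two_ne_zero |>.1 (le_antisymm h4 (by positivity))
  exact sub_eq_zero.1 (norm_eq_zero.1 h5)

theorem exists_prox (H : SmoothOnSublevel f₀ f B S G ℓ ρ) {x : V} (hx : x ∈ G) :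
    ∃ p, IsProxPoint (maxValue f₀ f B) S ℓ x p :=
  exists_isProxPoint ⟨x, H.subset hx⟩ H.nonneg H.continuousAt H.pos
    fun y hy => H.subset (H.lower x hx y hy)

theorem hasGradientAt_envelope (H : SmoothOnSublevel f₀ f B S G ℓ ρ) {x p : V} (hx : x ∈ G)
    (hp : IsProxPoint (maxValue f₀ f B) S ℓ x p) :
    HasGradientAt (moreauEnvelope (maxValue f₀ f B) S ℓ) ((2 * ℓ) • (x - p)) x :=
  hasGradientAt_moreauEnvelope H.nonneg H.continuousAt H.pos
    (fun y hy => H.subset (H.lower x hx y hy)) hp fun _ hq => H.prox_unique hx hp hq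

theorem segment_subset (H : SmoothOnSublevel f₀ f B S G ℓ ρ) {x p : V} (hx : x ∈ G)
    (hp : IsProxPoint (maxValue f₀ f B) S ℓ x p) : segment ℝ p x ⊆ G := by
  intro z hz
  refine H.mem_of_norm_le hx hp ?_
  have := dist_add_dist_of_mem_segment hz
  simp only [dist_eq_norm] at this
  linarith [norm_nonneg (z - x)]

/-- Correlation of the gradient of a maximizing function with the gradient of the envelope. -/
theorem le_inner_gradient (H : SmoothOnSublevel f₀ f B S G ℓ ρ) {x p : V} (hx : x ∈ G)
    (hp : IsProxPoint (maxValue f₀ f B) S ℓ x p) {l : EuclideanSpace ℝ ι} (hl : l ∈ B)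
    (hmax : IsMaxOn (affineLagrangian f₀ f x) B l) :
    ℓ * ‖x - p‖ ^ 2 ≤ inner ℝ (gradient (fun z => affineLagrangian f₀ f z l) x) (x - p) := by
  have hseg := H.segment_subset hx hp
  have h1 := H.maxValue_growth hp hseg
  -- Growth from p to x contributes 2ℓ - ℓ/2 and this bound from x back to p costs ℓ/2, leaving the
  -- coefficient ℓ.
  have h2 := H.lower_bound (segment_symm ℝ p x ▸ hseg) hl
  have h3 := affineLagrangian_le_maxValue (f₀ := f₀) (f := f) H.isCompact p hl
  rw [maxValue_eq_of_isMaxOn hl hmax, real_inner_self_eq_norm_sq] at h1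
  rw [← neg_sub x p, inner_neg_right, norm_neg] at h2
  linarith

/-- The local Lipschitz constant bounds the gradient of a maximizing function, at points that are
not stationary for the envelope. -/
theorem norm_gradient_le (H : SmoothOnSublevel f₀ f B S G ℓ ρ) {x p : V} (hx : x ∈ G)
    (hp : IsProxPoint (maxValue f₀ f B) S ℓ x p) (hne : x ≠ p) {l : EuclideanSpace ℝ ι}
    (hl : l ∈ B) (hmax : IsMaxOn (affineLagrangian f₀ f x) B l) {L r : ℝ} (hr : 0 < r)
    (hL : ∀ y ∈ G, ‖x - y‖ ≤ r →
      |affineLagrangian f₀ f x l - affineLagrangian f₀ f y l| ≤ L * ‖x - y‖) :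
    ‖gradient (fun z => affineLagrangian f₀ f z l) x‖ ≤ L := by
  set v := gradient (fun z => affineLagrangian f₀ f z l) x with hv
  have hgrad := hasGradientAt_affineLagrangian_gradient (H.diff₀ x (H.subset hx))
    (H.diff x (H.subset hx)) l
  have hd : 0 < ‖x - p‖ := norm_pos_iff.2 (sub_ne_zero.2 hne)
  have hin : 0 < inner ℝ v (x - p) :=
    lt_of_lt_of_le (by have := H.pos; positivity) (H.le_inner_gradient hx hp hl hmax)
  have hvpos : 0 < ‖v‖ := norm_pos_iff.2 fun h => by simp [h] at hin
  set s : ℕ → ℝ := fun k => 1 / ((k : ℝ) + 1) with hs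
  have hspos : ∀ k, 0 < s k := fun k => by simp only [hs]; positivity
  have hs0 : Tendsto s atTop (𝓝 0) := tendsto_one_div_add_atTop_nhds_zero_nat
  have hs0' : Tendsto s atTop (𝓝[≠] 0) :=
    tendsto_nhdsWithin_iff.2 ⟨hs0, Eventually.of_forall fun k => (hspos k).ne'⟩
  have hslope := (hgrad.tendsto_slope (h := -v) hs0')
  have hle : -(‖v‖ * L) ≤ inner ℝ v (-v) := by
    refine ge_of_tendsto hslope ?_
    have h1 : ∀ᶠ k in atTop, s k < r / ‖v‖ := hs0.eventually (gt_mem_nhds (by positivity))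
    have h2 : ∀ᶠ k in atTop, s k < 2 * inner ℝ v (x - p) / ‖v‖ ^ 2 :=
      hs0.eventually (gt_mem_nhds (by positivity))
    filter_upwards [h1, h2] with k hk1 hk2
    rw [lt_div_iff₀ (by positivity)] at hk1 hk2
    have hn : ‖x - (x + s k • -v)‖ = s k * ‖v‖ := by
      rw [sub_add_cancel_left, norm_neg, norm_smul, norm_neg, Real.norm_of_nonneg (hspos k).le]
    -- The Lipschitz bound compares points of G only, and x may lie on its boundary. Since ⟨v, x -
    -- p⟩ > 0, a small step along -v approaches p and stays in the ball known to lie in G.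
    have hmem : x + s k • -v ∈ G := by
      refine H.mem_of_norm_le hx hp ?_
      rw [norm_sub_rev, norm_sub_rev p x]
      refine le_of_sq_le_sq ?_ (norm_nonneg _)
      have e : x + s k • -v - p = (x - p) - s k • v := by
        rw [smul_neg]; abel
      rw [e, norm_sub_sq_real, inner_smul_right, norm_smul, mul_pow, Real.norm_eq_abs, sq_abs,
        real_inner_comm]
      have := hspos k
      nlinarith
    have h3 := (abs_le.1 (hL _ hmem (by rw [hn]; exact hk1.le))).2
    rw [hn] at h3
    rw [inv_mul_eq_div, le_div_iff₀ (hspos k)]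
    linarith
  rw [inner_neg_right, real_inner_self_eq_norm_sq] at hle
  nlinarith

/-- Decrease of the envelope along a gradient step. -/
theorem envelope_step_le (H : SmoothOnSublevel f₀ f B S G ℓ ρ) {x p : V} (hx : x ∈ G)
    (hp : IsProxPoint (maxValue f₀ f B) S ℓ x p) {l : EuclideanSpace ℝ ι}
    (hl : l ∈ B) (hmax : IsMaxOn (affineLagrangian f₀ f x) B l) {L η : ℝ} (hη : 0 ≤ η)
    (hv : ‖gradient (fun z => affineLagrangian f₀ f z l) x‖ ≤ L) :
    moreauEnvelope (maxValue f₀ f B) S ℓ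
      (x - η • gradient (fun z => affineLagrangian f₀ f z l) x) ≤
    moreauEnvelope (maxValue f₀ f B) S ℓ x - 2 * ℓ ^ 2 * η * ‖x - p‖ ^ 2 + ℓ * η ^ 2 * L ^ 2 := by
  have h1 := H.le_inner_gradient hx hp hl hmax
  set v := gradient (fun z => affineLagrangian f₀ f z l) x
  -- The old proximal point serves as competitor, so the new iterate need not be known to be in G or
  -- even in S.
  refine (moreauEnvelope_le H.nonneg H.pos _ hp.1).trans ?_
  have e : p - (x - η • v) = -((x - p) - η • v) := by abel
  rw [hp.2, e, norm_neg, norm_sub_sq_real, inner_smul_right, norm_smul, mul_pow, Real.norm_eq_abs,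
    sq_abs, real_inner_comm, norm_sub_rev p x]
  have h2 : ‖v‖ ^ 2 ≤ L ^ 2 := by gcongr
  have h3 : ℓ * η ^ 2 * ‖v‖ ^ 2 ≤ ℓ * η ^ 2 * L ^ 2 := by
    have := H.pos
    gcongr
  have h4 : 2 * ℓ * η * (ℓ * ‖x - p‖ ^ 2) ≤ 2 * ℓ * η * inner ℝ v (x - p) := by
    have := H.pos
    gcongr
  linarith

end SmoothOnSublevel

end WeaklyConvex

/-! ### Elements whose powers tend to zero, and stable recursions -/

section PowersTendToZero

variable {𝔸 : Type*} [NormedRing 𝔸]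

/-- Some 1 - aᵗ is invertible by the Neumann series, and 1 - a is one of its commuting factors. -/
theorem isUnit_one_sub_of_tendsto_pow [HasSummableGeomSeries 𝔸] {a : 𝔸}
    (h : Tendsto (fun t : ℕ => a ^ t) atTop (𝓝 0)) : IsUnit (1 - a) := by
  have h1 : ∀ᶠ t in atTop, ‖a ^ t‖ < 1 := by
    simpa using h.norm.eventually (gt_mem_nhds (by simp))
  obtain ⟨t, ht⟩ := h1.exists
  have h2 := isUnit_one_sub_of_norm_lt_one ht
  rw [← mul_neg_geom_sum] at h2
  have hc : Commute (1 - a) (∑ i ∈ Finset.range t, a ^ i) :=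
    Commute.sum_right _ _ _ fun i _ =>
      ((Commute.one_left _).sub_left ((Commute.refl a).pow_right i))
  exact (hc.isUnit_mul_iff.1 h2).1

/-- Choose N with ‖aᴺ‖ < 1/2. Splitting at N bounds a partial sum by the first N terms plus half of
itself. -/
theorem summable_norm_pow_of_tendsto_pow {a : 𝔸}
    (h : Tendsto (fun t : ℕ => a ^ t) atTop (𝓝 0)) : Summable fun t : ℕ => ‖a ^ t‖ := by
  have h1 : ∀ᶠ t in atTop, ‖a ^ t‖ < 1 / 2 := by
    simpa using h.norm.eventually (gt_mem_nhds (by simp))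
  obtain ⟨N, hN⟩ := h1.exists
  refine summable_of_sum_range_le (c := 2 * ∑ t ∈ Finset.range N, ‖a ^ t‖)
    (fun _ => norm_nonneg _) fun m => ?_
  have h2 : ∑ t ∈ Finset.range m, ‖a ^ t‖ ≤ ∑ t ∈ Finset.range (N + m), ‖a ^ t‖ :=
    Finset.sum_le_sum_of_subset_of_nonneg (Finset.range_mono (by omega))
      fun _ _ _ => norm_nonneg _
  have h3 := Finset.sum_range_add (fun t => ‖a ^ t‖) N m
  have h4 : ∑ t ∈ Finset.range m, ‖a ^ (N + t)‖ ≤ 1 / 2 * ∑ t ∈ Finset.range m, ‖a ^ t‖ := by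
    rw [Finset.mul_sum]
    refine Finset.sum_le_sum fun t _ => ?_
    rw [pow_add]
    exact (norm_mul_le _ _).trans (by gcongr)
  linarith

/-- Dominated convergence for series: for fixed s the term tends to zero, and a bound on δ times b
dominates. The truncated subtraction is harmless because s < t. -/
theorem tendsto_convolution_zero {b δ : ℕ → ℝ} (hb : Summable b) (hb0 : ∀ k, 0 ≤ b k)
    (hδ : Tendsto δ atTop (𝓝 0)) :
    Tendsto (fun t => ∑ s ∈ Finset.range t, b s * δ (t - 1 - s)) atTop (𝓝 0) := by
  obtain ⟨D, hD⟩ := hδ.norm.bddAbove_range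
  have h1 : Tendsto (fun t => ∑' s, if s < t then b s * δ (t - 1 - s) else 0) atTop
      (𝓝 (∑' _ : ℕ, (0 : ℝ))) := by
    refine tendsto_tsum_of_dominated_convergence (bound := fun s => b s * D) (hb.mul_right D)
      (fun s => ?_) (Eventually.of_forall fun t s => ?_)
    · have h2 : Tendsto (fun t => b s * δ (t - 1 - s)) atTop (𝓝 0) := by
        have : Tendsto (fun t : ℕ => t - 1 - s) atTop atTop := by
          simpa [Nat.sub_sub] using tendsto_sub_atTop_nat (1 + s)
        simpa using (hδ.comp this).const_mul (b s)
      refine h2.congr' ?_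
      filter_upwards [eventually_gt_atTop s] with t ht
      rw [if_pos ht]
    · have hD' : ‖δ (t - 1 - s)‖ ≤ D := hD ⟨_, rfl⟩
      split_ifs
      · rw [norm_mul, Real.norm_of_nonneg (hb0 s)]
        exact mul_le_mul_of_nonneg_left hD' (hb0 s)
      · simpa using mul_nonneg (hb0 s) ((norm_nonneg _).trans hD')
  rw [tsum_zero] at h1
  refine h1.congr fun t => ?_
  rw [tsum_eq_sum (s := Finset.range t)]
  · exact Finset.sum_congr rfl fun s hs => if_pos (Finset.mem_range.1 hs)
  · intro s hs
    exact if_neg (by simpa using hs)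

/-- A stable affine recursion with converging input converges to its fixed point. -/
theorem tendsto_of_stable_recursion {X : Type*} [NormedAddCommGroup X] [NormedSpace ℝ X]
    {T : X →L[ℝ] X} (hT : Tendsto (fun t : ℕ => T ^ t) atTop (𝓝 0)) {v d : ℕ → X} {p d' : X}
    (hv : ∀ t, v (t + 1) = T (v t) + d t) (hd : Tendsto d atTop (𝓝 d')) (hp : p = T p + d') :
    Tendsto v atTop (𝓝 p) := by
  -- Variation of constants, centred at the fixed point.
  have hform : ∀ t, v t - p =
      (T ^ t) (v 0 - p) + ∑ s ∈ Finset.range t, (T ^ s) (d (t - 1 - s) - d') := by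
    intro t
    induction t with
    | zero => simp
    | succ t ih =>
      have h1 : v (t + 1) - p = T (v t - p) + (d t - d') := by
        rw [hv, map_sub]
        nth_rewrite 1 [hp]
        abel
      rw [h1, ih, Finset.sum_range_succ', map_add, map_sum, pow_succ']
      simp only [pow_succ', mul_apply_eq_comp, pow_zero, one_apply_eq_self,
        Nat.add_sub_cancel, Nat.sub_zero, add_assoc]
      congr 2
      refine Finset.sum_congr rfl fun s _ => ?_
      rw [Nat.sub_sub, Nat.add_comm 1 s]
  rw [← tendsto_sub_nhds_zero_iff]
  refine squeeze_zero_norm (a := fun t => ‖T ^ t‖ * ‖v 0 - p‖ +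
    ∑ s ∈ Finset.range t, ‖T ^ s‖ * ‖d (t - 1 - s) - d'‖) (fun t => ?_) ?_
  · rw [hform]
    refine (norm_add_le _ _).trans (add_le_add ((T ^ t).le_opNorm _) ?_)
    exact (norm_sum_le _ _).trans (Finset.sum_le_sum fun s _ => (T ^ s).le_opNorm _)
  · have h1 : Tendsto (fun t : ℕ => ‖T ^ t‖ * ‖v 0 - p‖) atTop (𝓝 0) := by
      simpa using hT.norm.mul_const ‖v 0 - p‖
    have h2 : Tendsto (fun t => ‖d t - d'‖) atTop (𝓝 0) := by
      simpa using (hd.sub_const d').norm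
    simpa using h1.add (tendsto_convolution_zero (summable_norm_pow_of_tendsto_pow hT)
      (fun _ => norm_nonneg _) h2)

/-- The set of elements whose powers tend to zero is open. -/
theorem isOpen_tendsto_pow_zero : IsOpen {a : 𝔸 | Tendsto (fun t : ℕ => a ^ t) atTop (𝓝 0)} := by
  have : {a : 𝔸 | Tendsto (fun t : ℕ => a ^ t) atTop (𝓝 0)}
      = ⋃ N : ℕ, {a | ‖a ^ (N + 1)‖ < 1} := by
    ext a
    simp only [Set.mem_ofPred_eq, Set.mem_iUnion]
    constructor
    · intro h
      have h1 : ∀ᶠ t in atTop, ‖a ^ (t + 1)‖ < 1 := by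
        simpa using (h.comp (tendsto_add_atTop_nat 1)).norm.eventually (gt_mem_nhds (by simp))
      exact h1.exists
    · rintro ⟨N, hN⟩
      set D := ∑ r ∈ Finset.range (N + 1), ‖a ^ r‖ with hD
      refine squeeze_zero_norm (a := fun t => D * ‖a ^ (N + 1)‖ ^ (t / (N + 1))) (fun t => ?_) ?_
      · have hr : ‖a ^ (t % (N + 1))‖ ≤ D :=
          Finset.single_le_sum (f := fun r => ‖a ^ r‖) (fun _ _ => norm_nonneg _)
            (Finset.mem_range.2 (Nat.mod_lt _ (Nat.succ_pos N)))
        -- The zero exponent is treated apart since ‖1‖ ≤ 1 is not assumed in the ring.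
        rcases Nat.eq_zero_or_pos (t / (N + 1)) with h0 | h0
        · have : t % (N + 1) = t := by
            have := Nat.mod_add_div t (N + 1)
            rw [h0] at this; simpa using this
          rw [this] at hr
          simpa [h0] using hr
        · nth_rewrite 1 [← Nat.mod_add_div t (N + 1)]
          rw [pow_add, pow_mul]
          exact (norm_mul_le _ _).trans
            (mul_le_mul hr (norm_pow_le' _ h0) (norm_nonneg _) ((norm_nonneg _).trans hr))
      · have h1 : Tendsto (fun t : ℕ => t / (N + 1)) atTop atTop :=
          Nat.tendsto_div_const_atTop (Nat.succ_ne_zero N)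
        simpa using ((tendsto_pow_atTop_nhds_zero_of_lt_one (norm_nonneg _) hN).comp h1).const_mul D
  rw [this]
  exact isOpen_iUnion fun N => isOpen_lt (by fun_prop) continuous_const

end PowersTendToZero

/-! ### Stationary mean, covariance and second moment as resolvents -/

section StationaryMoments

variable {n : ℕ}

/-- The operator `x ↦ F x`, which propagates means. -/
def meanOp (F : Matrix (Fin n) (Fin n) ℝ) : (Fin n → ℝ) →L[ℝ] (Fin n → ℝ) :=
  LinearMap.toContinuousLinearMap F.mulVecLin

/-- The operator `X ↦ F X Fᵀ`, which propagates covariances. -/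
def covOp (F : Matrix (Fin n) (Fin n) ℝ) : (Fin n → Fin n → ℝ) →L[ℝ] (Fin n → Fin n → ℝ) :=
  LinearMap.toContinuousLinearMap
    { toFun := fun X => F * (of X) * Fᵀ
      map_add' := fun X Y => by
        change F * (of X + of Y) * Fᵀ = F * of X * Fᵀ + F * of Y * Fᵀ
        rw [mul_add, add_mul]
      map_smul' := fun c X => by
        change F * (c • of X) * Fᵀ = c • (F * of X * Fᵀ)
        rw [Matrix.mul_smul, Matrix.smul_mul] }

@[simp]
theorem meanOp_apply (F : Matrix (Fin n) (Fin n) ℝ) (x : Fin n → ℝ) : meanOp F x = F *ᵥ x := rfl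

theorem meanOp_pow (F : Matrix (Fin n) (Fin n) ℝ) (t : ℕ) : meanOp F ^ t = meanOp (F ^ t) := by
  induction t with
  | zero => exact ContinuousLinearMap.ext fun x => by simp
  | succ t ih =>
    rw [pow_succ, ih]
    refine ContinuousLinearMap.ext fun x => ?_
    simp [pow_succ, Matrix.mulVec_mulVec]

theorem covOp_pow (F : Matrix (Fin n) (Fin n) ℝ) (t : ℕ) : covOp F ^ t = covOp (F ^ t) := by
  induction t with
  | zero =>
    refine ContinuousLinearMap.ext fun X => ?_
    change X = (1 : Matrix (Fin n) (Fin n) ℝ) * of X * (1 : Matrix (Fin n) (Fin n) ℝ)ᵀ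
    rw [Matrix.transpose_one, Matrix.mul_one, Matrix.one_mul]
    rfl
  | succ t ih =>
    rw [pow_succ, ih]
    refine ContinuousLinearMap.ext fun X => ?_
    change F ^ t * (F * of X * Fᵀ) * (F ^ t)ᵀ = F ^ (t + 1) * of X * (F ^ (t + 1))ᵀ
    rw [pow_succ, Matrix.transpose_mul]
    simp only [Matrix.mul_assoc]

theorem continuous_meanOp : Continuous (meanOp (n := n)) := by
  rw [continuous_clm_apply]
  intro x
  simp only [meanOp_apply]
  fun_prop

theorem continuous_covOp : Continuous (covOp (n := n)) := by
  rw [continuous_clm_apply]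
  intro X
  change Continuous fun F : Matrix (Fin n) (Fin n) ℝ => F * of X * Fᵀ
  fun_prop

theorem tendsto_meanOp_pow {F : Matrix (Fin n) (Fin n) ℝ}
    (h : Tendsto (fun t : ℕ => F ^ t) atTop (𝓝 0)) :
    Tendsto (fun t : ℕ => meanOp F ^ t) atTop (𝓝 0) := by
  have h0 : meanOp (0 : Matrix (Fin n) (Fin n) ℝ) = 0 :=
    ContinuousLinearMap.ext fun x => by simp
  simp only [meanOp_pow]
  rw [← h0]
  exact (continuous_meanOp.tendsto 0).comp h

theorem tendsto_covOp_pow {F : Matrix (Fin n) (Fin n) ℝ}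
    (h : Tendsto (fun t : ℕ => F ^ t) atTop (𝓝 0)) :
    Tendsto (fun t : ℕ => covOp F ^ t) atTop (𝓝 0) := by
  have h0 : covOp (0 : Matrix (Fin n) (Fin n) ℝ) = 0 :=
    ContinuousLinearMap.ext fun X => by
      change (0 : Matrix (Fin n) (Fin n) ℝ) * of X * (0 : Matrix (Fin n) (Fin n) ℝ)ᵀ = 0
      simp
  simp only [covOp_pow]
  rw [← h0]
  exact (continuous_covOp.tendsto 0).comp h

/-- Transfers stability between matrices and the normed ring of operators, where the results on
powers apply. -/
theorem tendsto_meanOp_pow_iff {F : Matrix (Fin n) (Fin n) ℝ} :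
    Tendsto (fun t : ℕ => meanOp F ^ t) atTop (𝓝 0) ↔
      Tendsto (fun t : ℕ => F ^ t) atTop (𝓝 0) := by
  refine ⟨fun h => ?_, tendsto_meanOp_pow⟩
  simp only [meanOp_pow] at h
  refine tendsto_pi_nhds.2 fun i => tendsto_pi_nhds.2 fun j => ?_
  have h1 := ((ContinuousLinearMap.apply ℝ (Fin n → ℝ) (Pi.single j (1 : ℝ))).continuous.tendsto
    0).comp h
  simpa using (tendsto_pi_nhds.1 h1) i

/-- The set of matrices whose powers tend to zero is open. -/
theorem isOpen_tendsto_matrix_pow : IsOpen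
    {F : Matrix (Fin n) (Fin n) ℝ | Tendsto (fun t : ℕ => F ^ t) atTop (𝓝 0)} := by
  simp only [← tendsto_meanOp_pow_iff]
  exact isOpen_tendsto_pow_zero.preimage continuous_meanOp

/-- Stationary mean of `x_{t+1} = F x_t + w_t`. -/
def statMean (F : Matrix (Fin n) (Fin n) ℝ) (b : Fin n → ℝ) : Fin n → ℝ :=
  Ring.inverse (1 - meanOp F) b

/-- Stationary covariance of `x_{t+1} = F x_t + w_t`. -/
def statCov (F W : Matrix (Fin n) (Fin n) ℝ) : Matrix (Fin n) (Fin n) ℝ :=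
  of (Ring.inverse (1 - covOp F) W)

theorem ringInverse_one_sub_apply {X : Type*} [NormedAddCommGroup X] [NormedSpace ℝ X]
    {T : X →L[ℝ] X} (hT : IsUnit (1 - T)) (x : X) :
    Ring.inverse (1 - T) x = T (Ring.inverse (1 - T) x) + x := by
  have h := congrArg (fun U : X →L[ℝ] X => U x) (Ring.mul_inverse_cancel _ hT)
  simp only [mul_apply_eq_comp, one_apply_eq_self, _root_.sub_apply] at h
  rw [sub_eq_iff_eq_add] at h
  rw [add_comm]
  exact h

theorem statMean_eq {F : Matrix (Fin n) (Fin n) ℝ}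
    (h : Tendsto (fun t : ℕ => F ^ t) atTop (𝓝 0)) (b : Fin n → ℝ) :
    statMean F b = F *ᵥ statMean F b + b :=
  ringInverse_one_sub_apply (isUnit_one_sub_of_tendsto_pow (tendsto_meanOp_pow h)) b

theorem statCov_eq {F : Matrix (Fin n) (Fin n) ℝ}
    (h : Tendsto (fun t : ℕ => F ^ t) atTop (𝓝 0)) (W : Matrix (Fin n) (Fin n) ℝ) :
    statCov F W = F * statCov F W * Fᵀ + W :=
  ringInverse_one_sub_apply (isUnit_one_sub_of_tendsto_pow (tendsto_covOp_pow h)) W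

section Smooth

variable {V : Type*} [NormedAddCommGroup V] [NormedSpace ℝ V]
  {F : V → Matrix (Fin n) (Fin n) ℝ} {x : V}

/-- Inversion is smooth at units, so resolvents inherit the regularity of the operator. Order 2 is
what makes gradients of the costs locally Lipschitz. -/
theorem contDiffAt_ringInverse_one_sub_apply {X : Type*} [NormedAddCommGroup X] [NormedSpace ℝ X]
    [CompleteSpace X] {T : V → X →L[ℝ] X} (hT : ContDiffAt ℝ 2 T x)
    (h : Tendsto (fun t : ℕ => T x ^ t) atTop (𝓝 0)) (y : X) :
    ContDiffAt ℝ 2 (fun v => Ring.inverse (1 - T v) y) x := by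
  obtain ⟨u, hu⟩ := isUnit_one_sub_of_tendsto_pow h
  have h1 : ContDiffAt ℝ 2 Ring.inverse (1 - T x) := by
    rw [← hu]; exact contDiffAt_ringInverse ℝ u
  exact (h1.comp x (contDiffAt_const.sub hT)).clm_apply contDiffAt_const

theorem contDiffAt_statMean (hF : ∀ i j, ContDiff ℝ 2 fun v => F v i j)
    (h : Tendsto (fun t : ℕ => F x ^ t) atTop (𝓝 0)) (b : Fin n → ℝ) (i : Fin n) :
    ContDiffAt ℝ 2 (fun v => statMean (F v) b i) x := by
  refine contDiffAt_pi.1 (contDiffAt_ringInverse_one_sub_apply (T := fun v => meanOp (F v)) ?_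
    (tendsto_meanOp_pow h) b) i
  refine (contDiff_clm_apply_iff.2 fun y => contDiff_pi.2 fun j => ?_).contDiffAt
  simp only [meanOp_apply, mulVec, dotProduct]
  fun_prop

theorem contDiffAt_statCov (hF : ∀ i j, ContDiff ℝ 2 fun v => F v i j)
    (h : Tendsto (fun t : ℕ => F x ^ t) atTop (𝓝 0)) (W : Matrix (Fin n) (Fin n) ℝ)
    (i j : Fin n) : ContDiffAt ℝ 2 (fun v => statCov (F v) W i j) x := by
  refine contDiffAt_pi.1 (contDiffAt_pi.1 (contDiffAt_ringInverse_one_sub_apply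
    (T := fun v => covOp (F v)) ?_ (tendsto_covOp_pow h) W) i) j
  refine (contDiff_clm_apply_iff.2 fun X => contDiff_pi.2 fun a => contDiff_pi.2 fun b => ?_).contDiffAt
  change ContDiff ℝ 2 fun v => (F v * of X * (F v)ᵀ) a b
  simp only [Matrix.mul_apply, Matrix.transpose_apply, Matrix.of_apply]
  fun_prop

end Smooth

/-- Stationary second moment of `x_{t+1} = F x_t + w_t`. -/
def statMoment (F W : Matrix (Fin n) (Fin n) ℝ) (b : Fin n → ℝ) : Matrix (Fin n) (Fin n) ℝ :=
  statCov F W + vecMulVec (statMean F b) (statMean F b)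

/-- The fixed-point form of the second-moment recursion once the correlation between state and noise
has died out. -/
theorem statMoment_eq {F : Matrix (Fin n) (Fin n) ℝ}
    (h : Tendsto (fun t : ℕ => F ^ t) atTop (𝓝 0)) (W : Matrix (Fin n) (Fin n) ℝ)
    (b : Fin n → ℝ) :
    statMoment F W b = F * statMoment F W b * Fᵀ +
      (F * vecMulVec (statMean F b) b + (F * vecMulVec (statMean F b) b)ᵀ
        + (W + vecMulVec b b)) := by
  have h1 := statMean_eq h b
  have h2 := statCov_eq h W
  have h3 : vecMulVec (statMean F b) (statMean F b) =
      F * vecMulVec (statMean F b) (statMean F b) * Fᵀ + F * vecMulVec (statMean F b) b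
        + (F * vecMulVec (statMean F b) b)ᵀ + vecMulVec b b := by
    rw [mul_vecMulVec, mul_vecMulVec, vecMulVec_mul, transpose_vecMulVec, vecMul_transpose]
    conv_lhs => rw [h1]
    rw [vecMulVec_add, add_vecMulVec, add_vecMulVec]
    abel
  unfold statMoment
  rw [mul_add, add_mul]
  conv_lhs => rw [h2, h3]
  abel

end StationaryMoments

/-! ### Integrals of linear images of square-integrable vectors -/

section IntegralLemmas

variable {Ω : Type*} [MeasurableSpace Ω] {ℙ : Measure Ω} {n : ℕ}

theorem MeasureTheory.MemLp.integrable_fun_mul {u v : Ω → ℝ} (hu : MemLp u 2 ℙ)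
    (hv : MemLp v 2 ℙ) : Integrable (fun ω => u ω * v ω) ℙ :=
  hu.integrable_mul hv

theorem memLp_mulVec {x : Ω → Fin n → ℝ} (hx : ∀ i, MemLp (fun ω => x ω i) 2 ℙ) {k : ℕ}
    (F : Matrix (Fin k) (Fin n) ℝ) (i : Fin k) : MemLp (fun ω => (F *ᵥ x ω) i) 2 ℙ := by
  simp only [mulVec, dotProduct]
  exact memLp_finsetSum _ fun j _ => (hx j).const_mul (F i j)

theorem integral_mulVec [IsFiniteMeasure ℙ] {x : Ω → Fin n → ℝ}
    (hx : ∀ i, MemLp (fun ω => x ω i) 2 ℙ)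
    (F : Matrix (Fin n) (Fin n) ℝ) (i : Fin n) :
    ∫ ω, (F *ᵥ x ω) i ∂ℙ = (F *ᵥ fun j => ∫ ω, x ω j ∂ℙ) i := by
  simp only [mulVec, dotProduct]
  rw [integral_finsetSum _ fun j _ => ((hx j).integrable (by norm_num)).const_mul (F i j)]
  simp only [integral_const_mul]

theorem integral_mulVec_mul {x : Ω → Fin n → ℝ} (hx : ∀ i, MemLp (fun ω => x ω i) 2 ℙ)
    {v : Ω → ℝ} (hv : MemLp v 2 ℙ) (F : Matrix (Fin n) (Fin n) ℝ) (i : Fin n) :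
    ∫ ω, (F *ᵥ x ω) i * v ω ∂ℙ = ∑ k, F i k * ∫ ω, x ω k * v ω ∂ℙ := by
  simp only [mulVec, dotProduct, Finset.sum_mul, mul_assoc]
  rw [integral_finsetSum _ fun j _ => ((hx j).integrable_fun_mul hv).const_mul (F i j)]
  simp only [integral_const_mul]

end IntegralLemmas

/-! ### Moments of the closed loop, limits of the costs, regularity in the gain -/

namespace ConstrainedLQR

variable {n m : ℕ} {ι : Type*} [Fintype ι] {Ω : Type*} [MeasurableSpace Ω] {ℙ : Measure Ω}
  {E : Finset (Fin m × Fin n)}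

/-- The closed-loop matrix `A - B K`. -/
def closedLoop (P : ConstrainedLQR n m ι) (K : Gain E) : Matrix (Fin n) (Fin n) ℝ :=
  P.A - P.B * K.toMatrix

omit [Fintype ι] in
theorem state_succ (P : ConstrainedLQR n m ι) (N : NoiseModel n ℙ) (K : Gain E) (t : ℕ) (ω : Ω) :
    P.state N K (t + 1) ω = P.closedLoop K *ᵥ P.state N K t ω + N.w t ω := by
  simp only [state, closedLoop, Matrix.sub_mulVec, Matrix.mulVec_neg, Matrix.mulVec_mulVec]
  abel

omit [Fintype ι] in
theorem memLp_state (P : ConstrainedLQR n m ι) (N : NoiseModel n ℙ) (K : Gain E) (t : ℕ)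
    (i : Fin n) : MemLp (fun ω => P.state N K t ω i) 2 ℙ := by
  induction t generalizing i with
  | zero => exact N.x0_memLp i
  | succ t ih =>
    simp only [state_succ, Pi.add_apply]
    exact (memLp_mulVec ih _ i).add (N.w_memLp t i)

/-- The mean of the state. -/
def meanState (P : ConstrainedLQR n m ι) (N : NoiseModel n ℙ) (K : Gain E) (t : ℕ) : Fin n → ℝ :=
  fun i => ∫ ω, P.state N K t ω i ∂ℙ

/-- The matrix of second moments of the state. -/
def secondMoment (P : ConstrainedLQR n m ι) (N : NoiseModel n ℙ) (K : Gain E) (t : ℕ) :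
    Matrix (Fin n) (Fin n) ℝ :=
  of fun i j => ∫ ω, P.state N K t ω i * P.state N K t ω j ∂ℙ

/-- The correlation of the state with the centred noise. -/
def crossMoment (P : ConstrainedLQR n m ι) (N : NoiseModel n ℙ) (K : Gain E) (t s : ℕ) :
    Matrix (Fin n) (Fin n) ℝ :=
  of fun i j => ∫ ω, P.state N K t ω i * (N.w s ω j - N.wbar j) ∂ℙ

variable [IsProbabilityMeasure ℙ]

theorem _root_.NoiseModel.memLp_centred (N : NoiseModel n ℙ) (t : ℕ) (i : Fin n) :
    MemLp (fun ω => N.w t ω i - N.wbar i) 2 ℙ :=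
  (N.w_memLp t i).sub (memLp_const _)

theorem _root_.NoiseModel.integral_centred (N : NoiseModel n ℙ) (t : ℕ) (i : Fin n) :
    ∫ ω, (N.w t ω i - N.wbar i) ∂ℙ = 0 := by
  rw [integral_sub ((N.w_memLp t i).integrable (by norm_num)) (integrable_const _), N.w_mean]
  simp

omit [Fintype ι] in
theorem meanState_succ (P : ConstrainedLQR n m ι) (N : NoiseModel n ℙ) (K : Gain E) (t : ℕ) :
    P.meanState N K (t + 1) = P.closedLoop K *ᵥ P.meanState N K t + N.wbar := by
  ext i
  change ∫ ω, P.state N K (t + 1) ω i ∂ℙ =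
    (P.closedLoop K *ᵥ fun j => ∫ ω, P.state N K t ω j ∂ℙ) i + N.wbar i
  simp only [state_succ, Pi.add_apply]
  rw [integral_add ((memLp_mulVec (P.memLp_state N K t) _ i).integrable (by norm_num))
    ((N.w_memLp t i).integrable (by norm_num)), integral_mulVec (P.memLp_state N K t), N.w_mean]

omit [Fintype ι] in
theorem crossMoment_succ (P : ConstrainedLQR n m ι) (N : NoiseModel n ℙ) (K : Gain E) {t s : ℕ}
    (hts : t ≠ s) :
    P.crossMoment N K (t + 1) s = P.closedLoop K * P.crossMoment N K t s := by
  ext i j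
  have hx := memLp_mulVec (P.memLp_state N K t) (P.closedLoop K) i
  have hc := N.memLp_centred s j
  have hd := N.memLp_centred t i
  simp only [crossMoment, state_succ, Pi.add_apply, of_apply, Matrix.mul_apply]
  have e : ∀ ω, ((P.closedLoop K *ᵥ P.state N K t ω) i + N.w t ω i) * (N.w s ω j - N.wbar j)
      = (P.closedLoop K *ᵥ P.state N K t ω) i * (N.w s ω j - N.wbar j)
        + ((N.w t ω i - N.wbar i) * (N.w s ω j - N.wbar j)
          + N.wbar i * (N.w s ω j - N.wbar j)) := fun ω => by ring
  simp only [e]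
  rw [integral_add (hx.integrable_fun_mul hc) ((hd.integrable_fun_mul hc).fun_add
      ((hc.integrable (by norm_num)).const_mul _)),
    integral_add (hd.integrable_fun_mul hc) ((hc.integrable (by norm_num)).const_mul _),
    N.w_uncorr t s hts, integral_const_mul, N.integral_centred,
    integral_mulVec_mul (P.memLp_state N K t) hc]
  simp

omit [Fintype ι] in
-- The initial state may be correlated with the noise. Up to time s this correlation is only
-- propagated by the closed loop, since earlier noise is uncorrelated with noise at s.
theorem crossMoment_eq_pow (P : ConstrainedLQR n m ι) (N : NoiseModel n ℙ) (K : Gain E) {t s : ℕ}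
    (hts : t ≤ s) :
    P.crossMoment N K t s = P.closedLoop K ^ t * P.crossMoment N K 0 s := by
  induction t with
  | zero => simp
  | succ t ih =>
    rw [P.crossMoment_succ N K (by omega), ih (by omega), pow_succ', Matrix.mul_assoc]

omit [Fintype ι] in
-- From |ab| ≤ a² + b². What matters is that the bound does not depend on s, so that the factor
-- given by the closed-loop powers forces decay.
theorem abs_crossMoment_zero_le (P : ConstrainedLQR n m ι) (N : NoiseModel n ℙ) (K : Gain E)
    (s : ℕ) (i j : Fin n) :
    |P.crossMoment N K 0 s i j| ≤ (∫ ω, N.x0 ω i ^ 2 ∂ℙ) + N.W j j := by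
  have hx := N.x0_memLp i
  have hc := N.memLp_centred s j
  simp only [crossMoment, of_apply, state]
  rw [← N.w_cov s j j, ← integral_add hx.integrable_sq (hc.integrable_fun_mul hc)]
  refine abs_integral_le_integral_abs.trans (integral_mono (hx.integrable_fun_mul hc).abs
    (hx.integrable_sq.add (hc.integrable_fun_mul hc)) fun ω => ?_)
  simp only [abs_le]
  constructor <;>
  nlinarith [sq_nonneg (N.x0 ω i - (N.w s ω j - N.wbar j)),
    sq_nonneg (N.x0 ω i + (N.w s ω j - N.wbar j)), sq_nonneg (N.x0 ω i),
    sq_nonneg (N.w s ω j - N.wbar j)]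

omit [Fintype ι] in
theorem tendsto_crossMoment (P : ConstrainedLQR n m ι) (N : NoiseModel n ℙ) {K : Gain E}
    (hK : P.Stabilizing K) :
    Tendsto (fun t => P.crossMoment N K t t) atTop (𝓝 0) := by
  refine tendsto_pi_nhds.2 fun i => tendsto_pi_nhds.2 fun j => ?_
  simp only [P.crossMoment_eq_pow N K le_rfl, Matrix.mul_apply]
  have h : ∀ k, Tendsto (fun t => (P.closedLoop K ^ t) i k * P.crossMoment N K 0 t k j) atTop
      (𝓝 0) := by
    intro k
    have h1 : Tendsto (fun t : ℕ => (P.closedLoop K ^ t) i k) atTop (𝓝 0) :=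
      tendsto_pi_nhds.1 (tendsto_pi_nhds.1 hK i) k
    exact h1.zero_mul_isBoundedUnder_le
      ⟨_, eventually_map.2 (Eventually.of_forall fun t => P.abs_crossMoment_zero_le N K t k j)⟩
  simpa using tendsto_finsetSum Finset.univ fun k _ => h k

omit [Fintype ι] in
theorem secondMoment_succ (P : ConstrainedLQR n m ι) (N : NoiseModel n ℙ) (K : Gain E) (t : ℕ) :
    P.secondMoment N K (t + 1) = P.closedLoop K * P.secondMoment N K t * (P.closedLoop K)ᵀ +
      (P.closedLoop K * (P.crossMoment N K t t + vecMulVec (P.meanState N K t) N.wbar) +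
        (P.closedLoop K * (P.crossMoment N K t t + vecMulVec (P.meanState N K t) N.wbar))ᵀ +
        (N.W + vecMulVec N.wbar N.wbar)) := by
  have hx := P.memLp_state N K t
  have hFx := memLp_mulVec hx (P.closedLoop K)
  have hw := N.w_memLp t
  have h1 : ∀ i j, ∫ ω, (P.closedLoop K *ᵥ P.state N K t ω) i * (P.closedLoop K *ᵥ P.state N K t ω) j ∂ℙ
      = (P.closedLoop K * P.secondMoment N K t * (P.closedLoop K)ᵀ) i j := by
    intro i j
    rw [integral_mulVec_mul hx (hFx j), Matrix.mul_assoc, Matrix.mul_apply]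
    refine Finset.sum_congr rfl fun k _ => ?_
    congr 1
    simp only [mul_comm (P.state N K t _ k)]
    rw [integral_mulVec_mul hx (hx k), Matrix.mul_apply]
    refine Finset.sum_congr rfl fun l _ => ?_
    simp only [secondMoment, of_apply, transpose_apply]
    rw [mul_comm]
    simp only [mul_comm]
  have h2 : ∀ k j, ∫ ω, P.state N K t ω k * N.w t ω j ∂ℙ
      = (P.crossMoment N K t t + vecMulVec (P.meanState N K t) N.wbar) k j := by
    intro k j
    simp only [Matrix.add_apply, crossMoment, of_apply, vecMulVec_apply, meanState]
    rw [← integral_mul_const, ← integral_add ((hx k).integrable_fun_mul (N.memLp_centred t j))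
      (((hx k).integrable (by norm_num)).mul_const _)]
    congr 1
    ext ω
    ring
  have h3 : ∀ i j, ∫ ω, (P.closedLoop K *ᵥ P.state N K t ω) i * N.w t ω j ∂ℙ
      = (P.closedLoop K * (P.crossMoment N K t t + vecMulVec (P.meanState N K t) N.wbar)) i j := by
    intro i j
    rw [integral_mulVec_mul hx (hw j), Matrix.mul_apply]
    exact Finset.sum_congr rfl fun k _ => by rw [h2]
  have h4 : ∀ i j, ∫ ω, N.w t ω i * N.w t ω j ∂ℙ = N.W i j + vecMulVec N.wbar N.wbar i j := by
    intro i j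
    have e : ∀ ω, N.w t ω i * N.w t ω j = (N.w t ω i - N.wbar i) * (N.w t ω j - N.wbar j)
        + (N.w t ω i * N.wbar j + N.wbar i * (N.w t ω j - N.wbar j)) := fun ω => by ring
    simp only [e]
    have i1 := (hw i).integrable (q := 2) (by norm_num)
    have i2 := (N.memLp_centred t j).integrable (q := 2) (by norm_num)
    rw [integral_add ((N.memLp_centred t i).integrable_fun_mul (N.memLp_centred t j))
      ((i1.mul_const _).fun_add (i2.const_mul _)), integral_add (i1.mul_const _) (i2.const_mul _),
      N.w_cov, integral_mul_const, integral_const_mul, N.w_mean, N.integral_centred, vecMulVec_apply]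
    ring
  ext i j
  simp only [Matrix.add_apply (P.closedLoop K * P.secondMoment N K t * (P.closedLoop K)ᵀ),
    Matrix.add_apply (_ + _) (N.W + _), Matrix.add_apply N.W,
    Matrix.add_apply (P.closedLoop K * _) (P.closedLoop K * _)ᵀ, Matrix.transpose_apply
      (P.closedLoop K * _)]
  rw [← h1, ← h3, ← h3, ← h4]
  simp only [secondMoment, of_apply, state_succ, Pi.add_apply]
  have e : ∀ ω, ((P.closedLoop K *ᵥ P.state N K t ω) i + N.w t ω i) *
      ((P.closedLoop K *ᵥ P.state N K t ω) j + N.w t ω j)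
      = (P.closedLoop K *ᵥ P.state N K t ω) i * (P.closedLoop K *ᵥ P.state N K t ω) j
        + ((P.closedLoop K *ᵥ P.state N K t ω) i * N.w t ω j
          + (P.closedLoop K *ᵥ P.state N K t ω) j * N.w t ω i + N.w t ω i * N.w t ω j) :=
    fun ω => by ring
  simp only [e]
  have i1 := (hFx i).integrable_fun_mul (hw j)
  have i2 := (hFx j).integrable_fun_mul (hw i)
  have i3 := (hw i).integrable_fun_mul (hw j)
  rw [integral_add ((hFx i).integrable_fun_mul (hFx j)) ((i1.fun_add i2).fun_add i3),
    integral_add (i1.fun_add i2) i3, integral_add i1 i2]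

omit [Fintype ι] in
theorem tendsto_meanState (P : ConstrainedLQR n m ι) (N : NoiseModel n ℙ) {K : Gain E}
    (hK : P.Stabilizing K) :
    Tendsto (P.meanState N K) atTop (𝓝 (statMean (P.closedLoop K) N.wbar)) :=
  tendsto_of_stable_recursion (tendsto_meanOp_pow hK) (P.meanState_succ N K) tendsto_const_nhds
    (statMean_eq hK _)

omit [Fintype ι] in
-- A stable recursion for X ↦ F X Fᵀ whose input varies but converges: the cross moments vanish and
-- the means settle.
theorem tendsto_secondMoment (P : ConstrainedLQR n m ι) (N : NoiseModel n ℙ) {K : Gain E}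
    (hK : P.Stabilizing K) :
    Tendsto (P.secondMoment N K) atTop (𝓝 (statMoment (P.closedLoop K) N.W N.wbar)) := by
  have hd : Tendsto (fun t => P.closedLoop K *
        (P.crossMoment N K t t + vecMulVec (P.meanState N K t) N.wbar) +
      (P.closedLoop K * (P.crossMoment N K t t + vecMulVec (P.meanState N K t) N.wbar))ᵀ +
      (N.W + vecMulVec N.wbar N.wbar)) atTop
      (𝓝 (P.closedLoop K * vecMulVec (statMean (P.closedLoop K) N.wbar) N.wbar +
        (P.closedLoop K * vecMulVec (statMean (P.closedLoop K) N.wbar) N.wbar)ᵀ +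
        (N.W + vecMulVec N.wbar N.wbar))) := by
    have h1 : Tendsto (fun t => vecMulVec (P.meanState N K t) N.wbar) atTop
        (𝓝 (vecMulVec (statMean (P.closedLoop K) N.wbar) N.wbar)) := by
      have hc : Continuous fun v : Fin n → ℝ => vecMulVec v N.wbar := by fun_prop
      exact (hc.tendsto _).comp (P.tendsto_meanState N hK)
    have h2 := (P.tendsto_crossMoment N hK).add h1
    rw [zero_add] at h2
    have hc : Continuous fun X : Matrix (Fin n) (Fin n) ℝ => P.closedLoop K * X +
      (P.closedLoop K * X)ᵀ + (N.W + vecMulVec N.wbar N.wbar) := by fun_prop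
    exact (hc.tendsto _).comp h2
  exact tendsto_of_stable_recursion (X := Fin n → Fin n → ℝ) (tendsto_covOp_pow hK)
    (P.secondMoment_succ N K) hd (statMoment_eq hK N.W N.wbar)

/-- The stationary cost. -/
def statCost (P : ConstrainedLQR n m ι) (N : NoiseModel n ℙ)
    (Q' : Matrix (Fin n) (Fin n) ℝ) (R' : Matrix (Fin m) (Fin m) ℝ) (q' : Fin n → ℝ)
    (K : Gain E) : ℝ :=
  ((Q' + K.toMatrixᵀ * R' * K.toMatrix) * statMoment (P.closedLoop K) N.W N.wbar).trace
    + q' ⬝ᵥ statMean (P.closedLoop K) N.wbar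

theorem _root_.Matrix.dotProduct_mulVec_eq_sum {k : ℕ} (x : Fin k → ℝ)
    (G : Matrix (Fin k) (Fin k) ℝ) : x ⬝ᵥ (G *ᵥ x) = ∑ i, ∑ j, G i j * (x j * x i) := by
  simp only [dotProduct, mulVec, Finset.mul_sum]
  exact Finset.sum_congr rfl fun i _ => Finset.sum_congr rfl fun j _ => by ring

omit [Fintype ι] in
theorem integral_stageCost (P : ConstrainedLQR n m ι) (N : NoiseModel n ℙ)
    (Q' : Matrix (Fin n) (Fin n) ℝ) (R' : Matrix (Fin m) (Fin m) ℝ) (q' : Fin n → ℝ)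
    (K : Gain E) (T : ℕ) :
    ∫ ω, ∑ t ∈ Finset.range T, (P.state N K t ω ⬝ᵥ (Q' *ᵥ P.state N K t ω)
      + (-(K.toMatrix *ᵥ P.state N K t ω)) ⬝ᵥ (R' *ᵥ (-(K.toMatrix *ᵥ P.state N K t ω)))
      + q' ⬝ᵥ P.state N K t ω) ∂ℙ =
    ∑ t ∈ Finset.range T, (((Q' + K.toMatrixᵀ * R' * K.toMatrix) * P.secondMoment N K t).trace
      + q' ⬝ᵥ P.meanState N K t) := by
  have e : ∀ t ω, P.state N K t ω ⬝ᵥ (Q' *ᵥ P.state N K t ω)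
      + (-(K.toMatrix *ᵥ P.state N K t ω)) ⬝ᵥ (R' *ᵥ (-(K.toMatrix *ᵥ P.state N K t ω)))
      + q' ⬝ᵥ P.state N K t ω =
      (∑ i, ∑ j, (Q' + K.toMatrixᵀ * R' * K.toMatrix) i j *
        (P.state N K t ω j * P.state N K t ω i)) + ∑ i, q' i * P.state N K t ω i := by
    intro t ω
    rw [← Matrix.dotProduct_mulVec_eq_sum, Matrix.add_mulVec, dotProduct_add]
    congr 2
    rw [Matrix.mulVec_neg, neg_dotProduct_neg, ← Matrix.mulVec_mulVec, ← Matrix.mulVec_mulVec,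
      Matrix.dotProduct_mulVec _ K.toMatrixᵀ, Matrix.vecMul_transpose]
  have hx := P.memLp_state N K
  have i1 : ∀ t, ∀ i j, Integrable (fun ω => (Q' + K.toMatrixᵀ * R' * K.toMatrix) i j *
        (P.state N K t ω j * P.state N K t ω i)) ℙ := fun t i j =>
    ((hx t j).integrable_fun_mul (hx t i)).const_mul _
  have i2 : ∀ t, ∀ i, Integrable (fun ω => q' i * P.state N K t ω i) ℙ := fun t i =>
    ((hx t i).integrable (by norm_num)).const_mul _
  have i3 := fun t => integrable_finsetSum Finset.univ fun i _ =>
    integrable_finsetSum Finset.univ fun j _ => i1 t i j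
  have i4 := fun t => integrable_finsetSum Finset.univ fun i _ => i2 t i
  simp only [e]
  rw [integral_finsetSum _ fun t _ => (i3 t).fun_add (i4 t)]
  refine Finset.sum_congr rfl fun t _ => ?_
  rw [integral_add (i3 t) (i4 t), integral_finsetSum _ fun i _ =>
    integrable_finsetSum Finset.univ fun j _ => i1 t i j, integral_finsetSum _ fun i _ => i2 t i]
  congr 1
  · simp only [trace, diag_apply, Matrix.mul_apply (M := Q' + K.toMatrixᵀ * R' * K.toMatrix)]
    refine Finset.sum_congr rfl fun i _ => ?_
    rw [integral_finsetSum _ fun j _ => i1 t i j]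
    exact Finset.sum_congr rfl fun j _ => integral_const_mul _ _
  · exact Finset.sum_congr rfl fun j _ => integral_const_mul _ _

omit [Fintype ι] in
-- The expected stage cost is a continuous function of the first two moments and so converges;
-- Cesàro averages share its limit.
theorem tendsto_runningCost (P : ConstrainedLQR n m ι) (N : NoiseModel n ℙ)
    (Q' : Matrix (Fin n) (Fin n) ℝ) (R' : Matrix (Fin m) (Fin m) ℝ) (q' : Fin n → ℝ)
    {K : Gain E} (hK : P.Stabilizing K) :
    Tendsto (P.runningCost N Q' R' q' K) atTop (𝓝 (P.statCost N Q' R' q' K)) := by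
  have hc : Continuous fun X : Matrix (Fin n) (Fin n) ℝ × (Fin n → ℝ) =>
      ((Q' + K.toMatrixᵀ * R' * K.toMatrix) * X.1).trace + q' ⬝ᵥ X.2 := by fun_prop
  have h := ((hc.tendsto _).comp
    ((P.tendsto_secondMoment N hK).prodMk_nhds (P.tendsto_meanState N hK))).cesaro
  refine h.congr fun T => ?_
  rw [runningCost, integral_stageCost, one_div]
  rfl

omit [Fintype ι] in
theorem objective_eq (P : ConstrainedLQR n m ι) (N : NoiseModel n ℙ) {K : Gain E}
    (hK : P.Stabilizing K) : P.objective N K = P.statCost N P.Q P.R 0 K :=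
  (P.tendsto_runningCost N P.Q P.R 0 hK).limUnder_eq

omit [Fintype ι] in
theorem constraint_eq (P : ConstrainedLQR n m ι) (N : NoiseModel n ℙ) (i : ι) {K : Gain E}
    (hK : P.Stabilizing K) :
    P.constraint N i K = P.statCost N (P.Qc i) (P.Rc i) (P.qc i) K :=
  (P.tendsto_runningCost N (P.Qc i) (P.Rc i) (P.qc i) hK).limUnder_eq

omit [Fintype ι] in
theorem objective_nonneg (P : ConstrainedLQR n m ι) (N : NoiseModel n ℙ) {K : Gain E}
    (hK : P.Stabilizing K) : 0 ≤ P.objective N K := by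
  rw [P.objective_eq N hK]
  refine ge_of_tendsto' (P.tendsto_runningCost N P.Q P.R 0 hK) fun T => ?_
  refine mul_nonneg (by positivity) (integral_nonneg fun ω => Finset.sum_nonneg fun t _ => ?_)
  have h1 := P.Q_psd.dotProduct_mulVec_nonneg (P.state N K t ω)
  have h2 := P.R_psd.dotProduct_mulVec_nonneg (-(K.toMatrix *ᵥ P.state N K t ω))
  simp only [star_trivial] at h1 h2
  rw [zero_dotProduct, add_zero]
  exact add_nonneg h1 h2

theorem _root_.Gain.contDiff_toMatrix_apply (a : Fin m) (b : Fin n) :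
    ContDiff ℝ 2 fun K : Gain E => K.toMatrix a b := by
  simp only [Gain.toMatrix, of_apply]
  split_ifs <;> fun_prop

omit [Fintype ι] in
theorem contDiff_closedLoop_apply (P : ConstrainedLQR n m ι) (i j : Fin n) :
    ContDiff ℝ 2 fun K : Gain E => P.closedLoop K i j := by
  simp only [closedLoop, Matrix.sub_apply, Matrix.mul_apply]
  have := Gain.contDiff_toMatrix_apply (n := n) (m := m) (E := E)
  fun_prop

omit [Fintype ι] in
theorem isOpen_stabilizing (P : ConstrainedLQR n m ι) : IsOpen {K : Gain E | P.Stabilizing K} :=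
  isOpen_tendsto_matrix_pow.preimage (f := fun K : Gain E => P.closedLoop K)
    (continuous_matrix fun i j => (P.contDiff_closedLoop_apply i j).continuous)

omit [Fintype ι] [IsProbabilityMeasure ℙ] in
theorem contDiffAt_statCost (P : ConstrainedLQR n m ι) (N : NoiseModel n ℙ)
    (Q' : Matrix (Fin n) (Fin n) ℝ) (R' : Matrix (Fin m) (Fin m) ℝ) (q' : Fin n → ℝ)
    {K : Gain E} (hK : P.Stabilizing K) : ContDiffAt ℝ 2 (P.statCost N Q' R' q') K := by
  have h1 := contDiffAt_statMean P.contDiff_closedLoop_apply hK N.wbar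
  have h2 := contDiffAt_statCov P.contDiff_closedLoop_apply hK N.W
  have h3 : ∀ a b, ContDiffAt ℝ 2 (fun K : Gain E => K.toMatrix a b) K := fun a b =>
    (Gain.contDiff_toMatrix_apply a b).contDiffAt
  unfold statCost
  simp only [statMoment, trace, diag_apply, dotProduct, Matrix.mul_apply, Matrix.add_apply,
    vecMulVec_apply, transpose_apply]
  fun_prop

omit [Fintype ι] in
theorem contDiffAt_objective (P : ConstrainedLQR n m ι) (N : NoiseModel n ℙ) {K : Gain E}
    (hK : P.Stabilizing K) : ContDiffAt ℝ 2 (P.objective N) K :=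
  (P.contDiffAt_statCost N P.Q P.R 0 hK).congr_of_eventuallyEq <| by
    filter_upwards [P.isOpen_stabilizing.mem_nhds hK] with K' hK' using P.objective_eq N hK'

omit [Fintype ι] in
theorem contDiffAt_constraint (P : ConstrainedLQR n m ι) (N : NoiseModel n ℙ) (i : ι) {K : Gain E}
    (hK : P.Stabilizing K) : ContDiffAt ℝ 2 (P.constraint N i) K :=
  (P.contDiffAt_statCost N (P.Qc i) (P.Rc i) (P.qc i) hK).congr_of_eventuallyEq <| by
    filter_upwards [P.isOpen_stabilizing.mem_nhds hK] with K' hK' using P.constraint_eq N i hK'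

end ConstrainedLQR

/-! ### Trace inequalities and the Lyapunov series -/

section TraceInequalities

variable {k : ℕ}

theorem Matrix.PosSemidef.trace_mul_nonneg {G X : Matrix (Fin k) (Fin k) ℝ} (hG : G.PosSemidef)
    (hX : X.PosSemidef) : 0 ≤ (G * X).trace := by
  obtain ⟨_, v, rfl⟩ := Matrix.posSemidef_iff_eq_sum_vecMulVec.1 hX
  rw [Matrix.mul_sum, trace_sum]
  refine Finset.sum_nonneg fun i _ => ?_
  rw [mul_vecMulVec, trace_vecMulVec, dotProduct_comm]
  exact hG.dotProduct_mulVec_nonneg (v i)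

theorem Matrix.PosDef.exists_sub_smul_posSemidef {G : Matrix (Fin k) (Fin k) ℝ} (hG : G.PosDef) :
    ∃ q : ℝ, 0 < q ∧ (G - q • (1 : Matrix (Fin k) (Fin k) ℝ)).PosSemidef := by
  -- Any small positive q works; arguing with the filter also covers dimension zero, where there is
  -- no least eigenvalue.
  have h : ∀ᶠ q in 𝓝[>] (0 : ℝ), ∀ i, q ≤ hG.isHermitian.eigenvalues i := by
    refine eventually_all.2 fun i => ?_
    exact nhdsWithin_le_nhds (Iic_mem_nhds (hG.eigenvalues_pos i))
  obtain ⟨q, hq, hq0⟩ := (h.and self_mem_nhdsWithin).exists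
  refine ⟨q, hq0, ?_⟩
  have h1 : (diagonal fun i => hG.isHermitian.eigenvalues i - q).PosSemidef :=
    PosSemidef.diagonal fun i => sub_nonneg.2 (hq i)
  have h2 := h1.mul_mul_conjTranspose_same
    (hG.isHermitian.eigenvectorUnitary : Matrix (Fin k) (Fin k) ℝ)
  convert h2 using 1
  have h3 := hG.isHermitian.spectral_theorem
  have h4 : (hG.isHermitian.eigenvectorUnitary : Matrix (Fin k) (Fin k) ℝ) *
      (hG.isHermitian.eigenvectorUnitary : Matrix (Fin k) (Fin k) ℝ)ᴴ = 1 :=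
    Unitary.coe_mul_star_self hG.isHermitian.eigenvectorUnitary
  have h5 : (diagonal fun i => hG.isHermitian.eigenvalues i - q)
      = diagonal hG.isHermitian.eigenvalues - q • (1 : Matrix (Fin k) (Fin k) ℝ) := by
    ext i j
    rcases eq_or_ne i j with rfl | hij
    · simp
    · simp [hij]
  rw [h5, mul_sub, sub_mul, Matrix.mul_smul, Matrix.mul_one, Matrix.smul_mul, h4]
  congr 1

theorem le_trace_mul_of_sub_smul {G X : Matrix (Fin k) (Fin k) ℝ} {q : ℝ}
    (hG : (G - q • (1 : Matrix (Fin k) (Fin k) ℝ)).PosSemidef) (hX : X.PosSemidef) :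
    q * X.trace ≤ (G * X).trace := by
  have := hG.trace_mul_nonneg hX
  rw [sub_mul, trace_sub, Matrix.smul_mul, Matrix.one_mul, trace_smul, smul_eq_mul] at this
  linarith

theorem trace_mul_transpose_eq {j : ℕ} (M : Matrix (Fin j) (Fin k) ℝ) :
    (M * Mᵀ).trace = ∑ a, ∑ b, M a b ^ 2 := by
  simp [trace, Matrix.mul_apply, sq]

/-- The Lyapunov equation telescopes: partial sums equal the right side minus a remainder tending to
zero. They increase, hence lie below their limit. -/
theorem sum_le_trace_mul_statCov {F W G : Matrix (Fin k) (Fin k) ℝ}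
    (hF : Tendsto (fun t : ℕ => F ^ t) atTop (𝓝 0)) (hG : G.PosSemidef) (hW : W.PosSemidef)
    (t : ℕ) :
    ∑ s ∈ Finset.range t, (G * (F ^ s * W * (F ^ s)ᵀ)).trace ≤ (G * statCov F W).trace := by
  have h1 : ∀ t, ∑ s ∈ Finset.range t, (G * (F ^ s * W * (F ^ s)ᵀ)).trace
      = (G * statCov F W).trace - (G * (F ^ t * statCov F W * (F ^ t)ᵀ)).trace := by
    intro t
    induction t with
    | zero => simp
    | succ t ih =>
      rw [Finset.sum_range_succ, ih]
      have h2 : F ^ t * statCov F W * (F ^ t)ᵀ =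
          F ^ (t + 1) * statCov F W * (F ^ (t + 1))ᵀ + F ^ t * W * (F ^ t)ᵀ := by
        conv_lhs => rw [statCov_eq hF W]
        rw [mul_add, add_mul, pow_succ, Matrix.transpose_mul]
        simp only [Matrix.mul_assoc]
      rw [h2, mul_add, trace_add]
      ring
  have hmono : Monotone fun t => ∑ s ∈ Finset.range t, (G * (F ^ s * W * (F ^ s)ᵀ)).trace := by
    refine monotone_nat_of_le_succ fun t => ?_
    rw [Finset.sum_range_succ]
    have := hG.trace_mul_nonneg (hW.mul_mul_conjTranspose_same (F ^ t))
    rw [conjTranspose_eq_transpose_of_trivial] at this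
    linarith
  refine hmono.ge_of_tendsto ?_ t
  simp only [h1]
  have hc : Continuous fun Y : Matrix (Fin k) (Fin k) ℝ => (G * (Y * statCov F W * Yᵀ)).trace := by
    fun_prop
  simpa using ((hc.tendsto 0).comp hF).const_sub (G * statCov F W).trace

end TraceInequalities

theorem sum_sq_toMatrix {n m : ℕ} {E : Finset (Fin m × Fin n)} (K : Gain E) :
    ∑ a, ∑ b, K.toMatrix a b ^ 2 = ‖K‖ ^ 2 := by
  rw [EuclideanSpace.norm_sq_eq, ← Finset.sum_product', Finset.univ_product_univ]
  rw [← Finset.sum_subset (Finset.subset_univ E), ← Finset.sum_coe_sort E]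
  · refine Finset.sum_congr rfl fun e _ => ?_
    simp [Gain.toMatrix]
  · intro e _ he
    simp [Gain.toMatrix, he]

/-! ### Coercivity of the objective -/

namespace ConstrainedLQR

variable {n m : ℕ} {ι : Type*} {Ω : Type*} [MeasurableSpace Ω] {ℙ : Measure Ω}
  {E : Finset (Fin m × Fin n)} [IsProbabilityMeasure ℙ]

/-- The stationary mean adds a nonnegative rank-one contribution to the cost, which is dropped. -/
theorem sum_le_objective (P : ConstrainedLQR n m ι) (N : NoiseModel n ℙ)
    (hW : N.W.PosSemidef) {K : Gain E} (hK : P.Stabilizing K) (t : ℕ) :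
    ∑ s ∈ Finset.range t, ((P.Q + K.toMatrixᵀ * P.R * K.toMatrix) *
      (P.closedLoop K ^ s * N.W * (P.closedLoop K ^ s)ᵀ)).trace ≤ P.objective N K := by
  have hG : (P.Q + K.toMatrixᵀ * P.R * K.toMatrix).PosSemidef := by
    refine P.Q_psd.add ?_
    simpa [conjTranspose_eq_transpose_of_trivial] using
      P.R_psd.conjTranspose_mul_mul_same K.toMatrix
  refine (sum_le_trace_mul_statCov hK hG hW t).trans ?_
  rw [P.objective_eq N hK, statCost, statMoment, mul_add, trace_add, zero_dotProduct, add_zero]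
  have h := hG.trace_mul_nonneg (posSemidef_vecMulVec_self_star
    (statMean (P.closedLoop K) N.wbar))
  rw [star_trivial] at h
  exact le_add_of_nonneg_right h

/-- Coercivity: the sublevel sets of the objective lie in compact sets of stabilizing gains. -/
theorem exists_compact_of_objective_le (P : ConstrainedLQR n m ι) (N : NoiseModel n ℙ)
    (hQ : P.Q.PosDef) (hR : P.R.PosDef) (hW : N.W.PosDef) (a : ℝ) :
    ∃ C : Set (Gain E), IsCompact C ∧ C ⊆ {K | P.Stabilizing K} ∧
      ∀ K, P.Stabilizing K → P.objective N K ≤ a → K ∈ C := by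
  obtain ⟨q, hq, hQq⟩ := hQ.exists_sub_smul_posSemidef
  obtain ⟨r, hr, hRr⟩ := hR.exists_sub_smul_posSemidef
  obtain ⟨σ, hσ, hWσ⟩ := hW.exists_sub_smul_posSemidef
  have hcl : Continuous fun K : Gain E => P.closedLoop K :=
    continuous_matrix fun i j => (P.contDiff_closedLoop_apply i j).continuous
  -- Bounded square sums of the closed-loop powers are a closed condition that forces stability,
  -- unlike stability itself, so the intersection with a ball is compact.
  refine ⟨Metric.closedBall 0 (a / (σ * r) + 1) ∩
    ⋂ t : ℕ, {K | ∑ s ∈ Finset.range t, ∑ i, ∑ j, (P.closedLoop K ^ s) i j ^ 2 ≤ a / (q * σ)},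
    ?_, ?_, ?_⟩
  · refine (isCompact_closedBall _ _).inter_right (isClosed_iInter fun t => ?_)
    refine isClosed_le ?_ continuous_const
    refine continuous_finsetSum _ fun s _ => continuous_finsetSum _ fun i _ =>
      continuous_finsetSum _ fun j _ => ?_
    exact ((hcl.pow s).matrix_elem i j).pow 2
  · rintro K ⟨-, hK⟩
    rw [Set.mem_iInter] at hK
    refine tendsto_pi_nhds.2 fun i => tendsto_pi_nhds.2 fun j => ?_
    have hs : Summable fun s : ℕ => (P.closedLoop K ^ s) i j ^ 2 := by
      refine summable_of_sum_range_le (fun _ => sq_nonneg _) fun t =>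
        le_trans (Finset.sum_le_sum fun s _ => ?_) (hK t)
      calc (P.closedLoop K ^ s) i j ^ 2 ≤ ∑ j, (P.closedLoop K ^ s) i j ^ 2 :=
            Finset.single_le_sum (f := fun j => (P.closedLoop K ^ s) i j ^ 2)
              (fun _ _ => sq_nonneg _) (Finset.mem_univ j)
        _ ≤ ∑ i, ∑ j, (P.closedLoop K ^ s) i j ^ 2 :=
            Finset.single_le_sum (f := fun i => ∑ j, (P.closedLoop K ^ s) i j ^ 2)
              (fun _ _ => Finset.sum_nonneg fun _ _ => sq_nonneg _) (Finset.mem_univ i)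
    have h0 := (hs.tendsto_atTop_zero.sqrt)
    simp only [Real.sqrt_sq_eq_abs, Real.sqrt_zero] at h0
    exact (tendsto_zero_iff_abs_tendsto_zero _).2 h0
  · intro K hK ha
    have hWs := hW.posSemidef
    have hKRK : (K.toMatrixᵀ * P.R * K.toMatrix).PosSemidef := by
      simpa [conjTranspose_eq_transpose_of_trivial] using
        P.R_psd.conjTranspose_mul_mul_same K.toMatrix
    constructor
    -- The term s = 0 alone controls the gain: tr(KᵀRK W) ≥ σ r ‖K‖².
    · have h1 := P.sum_le_objective N hWs hK 1
      rw [Finset.sum_range_one, pow_zero, Matrix.transpose_one, Matrix.mul_one, Matrix.one_mul,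
        add_mul, trace_add] at h1
      have h2 := P.Q_psd.trace_mul_nonneg hWs
      have h3 := le_trace_mul_of_sub_smul hWσ hKRK
      have h4 : (K.toMatrix * K.toMatrixᵀ).PosSemidef := by
        simpa [conjTranspose_eq_transpose_of_trivial] using
          posSemidef_self_mul_conjTranspose K.toMatrix
      have h5 := le_trace_mul_of_sub_smul hRr h4
      rw [trace_mul_transpose_eq, sum_sq_toMatrix] at h5
      have h6 : (K.toMatrixᵀ * P.R * K.toMatrix).trace
          = (P.R * (K.toMatrix * K.toMatrixᵀ)).trace := by
        rw [Matrix.mul_assoc, trace_mul_comm, Matrix.mul_assoc]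
      rw [h6] at h3
      rw [trace_mul_comm (K.toMatrixᵀ * P.R * K.toMatrix)] at h1
      have h7 : σ * (r * ‖K‖ ^ 2) ≤ a := by
        have := mul_le_mul_of_nonneg_left h5 hσ.le
        linarith
      have h8 : ‖K‖ ^ 2 ≤ a / (σ * r) := by
        rw [le_div_iff₀ (by positivity)]
        linarith
      rw [mem_closedBall_zero_iff]
      nlinarith [sq_nonneg (‖K‖ - 1)]
    · refine Set.mem_iInter.2 fun t => ?_
      -- Each summand is at least qσ times the squared Frobenius norm of the corresponding
      -- closed-loop power.
      have h1 := (P.sum_le_objective N hWs hK t).trans ha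
      rw [Set.mem_ofPred_eq, le_div_iff₀ (by positivity), Finset.sum_mul]
      refine le_trans (Finset.sum_le_sum fun s _ => ?_) h1
      have h2 : (P.Q + K.toMatrixᵀ * P.R * K.toMatrix
          - q • (1 : Matrix (Fin n) (Fin n) ℝ)).PosSemidef := by
        rw [add_sub_right_comm]
        exact hQq.add hKRK
      have h3 : (P.closedLoop K ^ s * N.W * (P.closedLoop K ^ s)ᵀ).PosSemidef := by
        simpa [conjTranspose_eq_transpose_of_trivial] using
          hWs.mul_mul_conjTranspose_same (P.closedLoop K ^ s)
      refine le_trans ?_ (le_trace_mul_of_sub_smul h2 h3)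
      have h4 : ((P.closedLoop K ^ s)ᵀ * P.closedLoop K ^ s).PosSemidef := by
        simpa [conjTranspose_eq_transpose_of_trivial] using
          posSemidef_conjTranspose_mul_self (P.closedLoop K ^ s)
      have h5 := le_trace_mul_of_sub_smul hWσ h4
      rw [trace_mul_comm (P.closedLoop K ^ s)ᵀ, trace_mul_transpose_eq] at h5
      have h6 : (P.closedLoop K ^ s * N.W * (P.closedLoop K ^ s)ᵀ).trace
          = (N.W * ((P.closedLoop K ^ s)ᵀ * P.closedLoop K ^ s)).trace := by
        rw [Matrix.mul_assoc, trace_mul_comm, Matrix.mul_assoc]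
      rw [h6]
      have := mul_le_mul_of_nonneg_left h5 hq.le
      linarith

end ConstrainedLQR

/-! ### Uniform local Lipschitz bounds on compact sets -/

section LocallyLipschitz

variable {V : Type*} [NormedAddCommGroup V] [InnerProductSpace ℝ V] [FiniteDimensional ℝ V]

theorem ContDiffAt.gradient {f : V → ℝ} {x : V} (hf : ContDiffAt ℝ 2 f x) :
    ContDiffAt ℝ 1 (_root_.gradient f) x := by
  have h1 : ContDiffAt ℝ 1 (fderiv ℝ f) x := hf.fderiv_right (by norm_num)
  exact (InnerProductSpace.toDual ℝ V).symm.toContinuousLinearEquiv.contDiff.contDiffAt.comp x h1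

/-- Compactness patches the local constants together; only the first point is confined to the
compact set. -/
theorem IsCompact.exists_uniform_locally_lipschitz {X Y : Type*} [NormedAddCommGroup X]
    [NormedSpace ℝ X] [NormedAddCommGroup Y] [NormedSpace ℝ Y] {g : X → Y} {C : Set X}
    (hC : IsCompact C) (hg : ∀ x ∈ C, ContDiffAt ℝ 1 g x) :
    ∃ M > 0, ∃ δ > 0, ∀ x ∈ C, ∀ y, ‖x - y‖ ≤ δ → ‖g x - g y‖ ≤ M * ‖x - y‖ := by
  refine hC.induction_on (p := fun C => ∃ M > 0, ∃ δ > 0, ∀ x ∈ C, ∀ y, ‖x - y‖ ≤ δ →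
    ‖g x - g y‖ ≤ M * ‖x - y‖) ⟨1, one_pos, 1, one_pos, by simp⟩ ?_ ?_ ?_
  · rintro s t hst ⟨M, hM, δ, hδ, h⟩
    exact ⟨M, hM, δ, hδ, fun x hx => h x (hst hx)⟩
  · rintro s t ⟨M, hM, δ, hδ, h⟩ ⟨M', hM', δ', hδ', h'⟩
    refine ⟨max M M', lt_max_of_lt_left hM, min δ δ', lt_min hδ hδ', ?_⟩
    rintro x (hx | hx) y hxy
    · exact (h x hx y (hxy.trans (min_le_left _ _))).trans (by gcongr; exact le_max_left _ _)
    · exact (h' x hx y (hxy.trans (min_le_right _ _))).trans (by gcongr; exact le_max_right _ _)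
  · intro x hx
    obtain ⟨M, u, hu, hL⟩ := (hg x hx).exists_lipschitzOnWith
    obtain ⟨r, hr, hball⟩ := Metric.mem_nhds_iff.1 hu
    refine ⟨Metric.ball x (r / 2), mem_nhdsWithin_of_mem_nhds (Metric.ball_mem_nhds x (by positivity)),
      M + 1, by positivity, r / 4, by positivity, fun y hy z hyz => ?_⟩
    have hz : z ∈ Metric.ball x r := by
      rw [mem_ball_iff_norm] at hy ⊢
      have : ‖z - x‖ ≤ ‖y - z‖ + ‖y - x‖ := by
        rw [norm_sub_rev y z]
        simpa using norm_add_le (z - y) (y - x)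
      linarith
    have h1 := hL.norm_sub_le (hball (Metric.ball_subset_ball (by linarith) hy)) (hball hz)
    refine h1.trans ?_
    gcongr
    linarith

end LocallyLipschitz

/-! ### The multiplier box and its projection -/

section Box

variable {ι : Type*} [Fintype ι] {Λ : ℝ}

theorem multiplierBox_eq_image :
    multiplierBox ι Λ = WithLp.toLp 2 '' (Set.univ.pi fun _ : ι => Set.Icc 0 Λ) := by
  ext l
  constructor
  · intro hl
    exact ⟨l.ofLp, fun i _ => hl i, rfl⟩
  · rintro ⟨x, hx, rfl⟩ i
    exact hx i (Set.mem_univ i)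

theorem isCompact_multiplierBox : IsCompact (multiplierBox ι Λ) := by
  rw [multiplierBox_eq_image]
  exact (isCompact_univ_pi fun _ => isCompact_Icc).image (PiLp.continuous_toLp 2 _)

theorem convex_multiplierBox : Convex ℝ (multiplierBox ι Λ) := fun _ hl _ hl' _ _ ha hb hab i =>
  (convex_Icc 0 Λ) (hl i) (hl' i) ha hb hab

theorem zero_mem_multiplierBox (hΛ : 0 ≤ Λ) : (0 : EuclideanSpace ℝ ι) ∈ multiplierBox ι Λ :=
  fun _ => ⟨le_rfl, hΛ⟩

/-- Maximizers of a linear function over the box are fixed by projected gradient steps. -/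
theorem projBox_add_smul_eq {g l : EuclideanSpace ℝ ι} {s : ℝ} (hs : 0 ≤ s)
    (hl : l ∈ multiplierBox ι Λ)
    (hmax : ∀ l' ∈ multiplierBox ι Λ, ∑ i, l' i * g i ≤ ∑ i, l i * g i) :
    projBox Λ (l + s • g) = l := by
  classical
  ext i
  -- Changing one coordinate at a time: a linear maximizer over a box maximizes coordinatewise, so a
  -- nonzero slope pins it to an endpoint.
  have key : ∀ t, 0 ≤ t → t ≤ Λ → t * g i ≤ l i * g i := by
    intro t h0 ht
    have hmem : WithLp.toLp 2 (Function.update l.ofLp i t) ∈ multiplierBox ι Λ := by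
      intro j
      rcases eq_or_ne j i with rfl | hj
      · simpa using ⟨h0, ht⟩
      · simpa [hj] using hl j
    have h := hmax _ hmem
    rw [← Finset.add_sum_erase _ _ (Finset.mem_univ i),
      ← Finset.add_sum_erase _ (fun i => l i * g i) (Finset.mem_univ i)] at h
    have e : ∑ j ∈ Finset.univ.erase i, Function.update l.ofLp i t j * g j
        = ∑ j ∈ Finset.univ.erase i, l j * g j :=
      Finset.sum_congr rfl fun j hj => by rw [Function.update_of_ne (Finset.ne_of_mem_erase hj)]
    simp only [e, Function.update_self] at h
    linarith
  obtain ⟨h0, h1⟩ := hl i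
  change max 0 (min Λ (l i + s * g i)) = l i
  rcases lt_trichotomy (g i) 0 with hg | hg | hg
  · have h2 : l i = 0 := by
      have := key 0 le_rfl (h0.trans h1)
      nlinarith
    rw [h2, max_eq_left]
    exact (min_le_right _ _).trans (by nlinarith)
  · rw [hg, mul_zero, add_zero, min_eq_right h1, max_eq_right h0]
  · have h2 : l i = Λ := by
      have := key Λ (h0.trans h1) le_rfl
      exact le_antisymm h1 (le_of_mul_le_mul_right this hg)
    rw [h2, min_eq_left (by nlinarith), max_eq_right (h2 ▸ h0)]

end Box

/-! ### The LQR problem as an instance; existence of constants; one step of GDmax -/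

namespace ConstrainedLQR

variable {n m : ℕ} {ι : Type*} [Fintype ι] {Ω : Type*} [MeasurableSpace Ω] {ℙ : Measure Ω}
  {E : Finset (Fin m × Fin n)}

theorem Phi_eq_maxValue (P : ConstrainedLQR n m ι) (N : NoiseModel n ℙ) (Λ : ℝ) :
    P.Phi N Λ = maxValue (V := Gain E) (P.objective N) (fun i K => P.constraint N i K - P.c i)
      (multiplierBox ι Λ) := rfl

theorem envelope_eq (P : ConstrainedLQR n m ι) (N : NoiseModel n ℙ) (Λ ℓ₀ : ℝ) :
    P.envelope N Λ ℓ₀ = moreauEnvelope (maxValue (V := Gain E) (P.objective N)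
      (fun i K => P.constraint N i K - P.c i) (multiplierBox ι Λ)) {K | P.Stabilizing K} ℓ₀ := by
  ext K
  have h : 1 / (2 * (1 / (2 * ℓ₀))) = ℓ₀ := by
    rw [one_div, mul_inv, one_div, inv_inv]; ring
  unfold envelope moreau moreauEnvelope
  rw [h, Phi_eq_maxValue]

variable [IsProbabilityMeasure ℙ]

theorem differentiableAt_lagrangian (P : ConstrainedLQR n m ι) (N : NoiseModel n ℙ) {K : Gain E}
    (hK : P.Stabilizing K) (l : EuclideanSpace ℝ ι) :
    DifferentiableAt ℝ (fun K' : Gain E => P.lagrangian N K' l) K := by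
  have h1 := (P.contDiffAt_objective N hK).differentiableAt (by norm_num)
  have h2 := fun i => (P.contDiffAt_constraint N i hK).differentiableAt (by norm_num)
  unfold lagrangian
  fun_prop

theorem gradK_eq (P : ConstrainedLQR n m ι) (N : NoiseModel n ℙ) {K : Gain E}
    (hK : P.Stabilizing K) (l : EuclideanSpace ℝ ι) :
    P.gradK N K l = gradient (P.objective N) K + ∑ i, l i • gradient (P.constraint N i) K := by
  refine (hasGradientAt_affineLagrangian (f := fun i K => P.constraint N i K - P.c i)
    ((P.contDiffAt_objective N hK).differentiableAt (by norm_num)).hasGradientAt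
    (fun i => ?_) l).gradient
  have h := ((P.contDiffAt_constraint N i hK).differentiableAt (by norm_num)).hasGradientAt
  rw [hasGradientAt_iff_hasFDerivAt] at h ⊢
  exact h.sub_const _

omit [IsProbabilityMeasure ℙ] in
theorem objective_le_Phi (P : ConstrainedLQR n m ι) (N : NoiseModel n ℙ) {Λ : ℝ} (hΛ : 0 ≤ Λ)
    (K : Gain E) : P.objective N K ≤ P.Phi N Λ K := by
  have h := affineLagrangian_le_maxValue (f₀ := P.objective N)
    (f := fun i K => P.constraint N i K - P.c i) isCompact_multiplierBox K
    (zero_mem_multiplierBox (ι := ι) hΛ)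
  rw [P.Phi_eq_maxValue]
  simpa [affineLagrangian] using h

theorem maxValue_nonneg (P : ConstrainedLQR n m ι) (N : NoiseModel n ℙ) {Λ : ℝ} (hΛ : 0 ≤ Λ) :
    ∀ K ∈ {K : Gain E | P.Stabilizing K}, 0 ≤ maxValue (P.objective N)
      (fun i K => P.constraint N i K - P.c i) (multiplierBox ι Λ) K := fun K hK =>
  (P.objective_nonneg N hK).trans (P.objective_le_Phi N hΛ K)

omit [IsProbabilityMeasure ℙ] in
theorem gradMultiplier_eq (P : ConstrainedLQR n m ι) (N : NoiseModel n ℙ) (K : Gain E)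
    (l : EuclideanSpace ℝ ι) :
    P.gradMultiplier N K l = WithLp.toLp 2 fun i => P.constraint N i K - P.c i := by
  have h : HasGradientAt (fun l' : EuclideanSpace ℝ ι => P.lagrangian N K l')
      (WithLp.toLp 2 fun i => P.constraint N i K - P.c i) l := by
    rw [hasGradientAt_iff_hasFDerivAt]
    have h1 := ((InnerProductSpace.toDual ℝ (EuclideanSpace ℝ ι)
      (WithLp.toLp 2 fun i => P.constraint N i K - P.c i)).hasFDerivAt (x := l)).const_add
      (P.objective N K)
    refine h1.congr_of_eventuallyEq (Eventually.of_forall fun l' => ?_)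
    simp [lagrangian, PiLp.inner_apply]
  exact h.gradient

/-- Uniform local Lipschitz constants of the Lagrangian and its gradient on compact sets. -/
theorem exists_uniform_constants (P : ConstrainedLQR n m ι) (N : NoiseModel n ℙ) {Λ : ℝ}
    (hΛ : 0 ≤ Λ) {C : Set (Gain E)} (hC : IsCompact C) (hCS : C ⊆ {K | P.Stabilizing K}) :
    ∃ M > 0, ∃ δ > 0, ∀ K ∈ C, ∀ K' ∈ C, ‖K - K'‖ ≤ δ → ∀ l ∈ multiplierBox ι Λ,
      |P.lagrangian N K l - P.lagrangian N K' l| ≤ M * ‖K - K'‖ ∧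
      ‖P.gradK N K l - P.gradK N K' l‖ ≤ M * ‖K - K'‖ := by
  obtain ⟨M₁, hM₁, δ₁, hδ₁, h₁⟩ := hC.exists_uniform_locally_lipschitz
    (g := fun K => (P.objective N K, gradient (P.objective N) K)) fun K hK =>
      ((P.contDiffAt_objective N (hCS hK)).of_le (by norm_num)).prodMk
        (P.contDiffAt_objective N (hCS hK)).gradient
  obtain ⟨M₂, hM₂, δ₂, hδ₂, h₂⟩ := hC.exists_uniform_locally_lipschitz
    (g := fun K i => (P.constraint N i K, gradient (P.constraint N i) K)) fun K hK =>
      contDiffAt_pi.2 fun i => ((P.contDiffAt_constraint N i (hCS hK)).of_le (by norm_num)).prodMk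
        (P.contDiffAt_constraint N i (hCS hK)).gradient
  refine ⟨M₁ + ∑ _ : ι, Λ * M₂, by positivity, min δ₁ δ₂, lt_min hδ₁ hδ₂,
    fun K hK K' hK' hd l hl => ?_⟩
  have e₁ := h₁ K hK K' (hd.trans (min_le_left _ _))
  have e₂ := h₂ K hK K' (hd.trans (min_le_right _ _))
  rw [pi_norm_le_iff_of_nonneg (by positivity)] at e₂
  simp only [Pi.sub_apply, Prod.mk_sub_mk, Prod.norm_mk, sup_le_iff] at e₁ e₂
  rw [add_mul, Finset.sum_mul]
  have hl' : ∀ i, |l i| ≤ Λ := fun i => by rw [abs_of_nonneg (hl i).1]; exact (hl i).2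
  constructor
  · have e : P.lagrangian N K l - P.lagrangian N K' l = (P.objective N K - P.objective N K')
        + ∑ i, l i * (P.constraint N i K - P.constraint N i K') := by
      simp only [lagrangian, mul_sub, Finset.sum_sub_distrib]
      ring
    rw [e]
    refine (abs_add_le _ _).trans (add_le_add e₁.1 ((Finset.abs_sum_le_sum_abs _ _).trans
      (Finset.sum_le_sum fun i _ => ?_)))
    rw [abs_mul, mul_assoc]
    exact mul_le_mul (hl' i) (e₂ i).1 (abs_nonneg _) hΛ
  · have e : P.gradK N K l - P.gradK N K' l =
        (gradient (P.objective N) K - gradient (P.objective N) K')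
        + ∑ i, l i • (gradient (P.constraint N i) K - gradient (P.constraint N i) K') := by
      rw [P.gradK_eq N (hCS hK), P.gradK_eq N (hCS hK')]
      simp only [smul_sub, Finset.sum_sub_distrib]
      abel
    rw [e]
    refine (norm_add_le _ _).trans (add_le_add e₁.2 ((norm_sum_le _ _).trans
      (Finset.sum_le_sum fun i _ => ?_)))
    rw [norm_smul, mul_assoc]
    exact mul_le_mul (hl' i) (e₂ i).2 (norm_nonneg _) hΛ

/-- The circularity between ℓ₀ and G⁰ is broken by confining G⁰, for all large ℓ₀, to a fixed
compact neighbourhood of an objective sublevel set. A near-minimizer for K ∈ G⁰ has objective at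
most Φ(K₀) + 1, and K is within δ of it once ℓ₀δ² ≥ Φ(K₀) + 1. -/
theorem eventually_exists_isConstants (P : ConstrainedLQR n m ι) (N : NoiseModel n ℙ) {Λ : ℝ}
    (hΛ : 0 ≤ Λ) {K₀ : Gain E} (hK₀ : P.Stabilizing K₀) (hQ : P.Q.PosDef) (hR : P.R.PosDef)
    (hW : N.W.PosDef) :
    ∀ᶠ ℓ₀ in atTop, ∃ L₀ ρ₀ : ℝ, 0 < ρ₀ ∧ P.IsConstants N Λ K₀ L₀ ℓ₀ ρ₀ := by
  set a := P.Phi N Λ K₀ with ha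
  obtain ⟨C, hC, hCS, hmem⟩ := P.exists_compact_of_objective_le (E := E) N hQ hR hW (a + 1)
  obtain ⟨δ, hδ, hδS⟩ := hC.exists_cthickening_subset_open P.isOpen_stabilizing hCS
  obtain ⟨M, hM, ρ, hρ, hlip⟩ := P.exists_uniform_constants N hΛ (hC.cthickening (r := δ)) hδS
  filter_upwards [eventually_gt_atTop 0, eventually_ge_atTop M,
    eventually_ge_atTop ((a + 1) / δ ^ 2)] with ℓ hℓ hMℓ hδℓ
  rw [div_le_iff₀ (by positivity)] at hδℓ
  have hG : ∀ K ∈ P.sublevel N Λ ℓ K₀, K ∈ Metric.cthickening δ C := by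
    intro K hK
    have hK : P.envelope N Λ ℓ K ≤ P.envelope N Λ ℓ K₀ := hK
    rw [envelope_eq] at hK
    have h1 := moreauEnvelope_le (P.maxValue_nonneg N hΛ) hℓ K₀ hK₀
    rw [sub_self, norm_zero, ← Phi_eq_maxValue] at h1
    obtain ⟨K', hK', hlt⟩ := exists_lt_moreauEnvelope_add
      (Φ := maxValue (P.objective N) (fun i K => P.constraint N i K - P.c i) (multiplierBox ι Λ))
      (S := {K | P.Stabilizing K}) (ℓ := ℓ) ⟨K₀, hK₀⟩ K one_pos
    have h2 := P.objective_nonneg N hK'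
    have h3 := P.objective_le_Phi N hΛ K'
    rw [← Phi_eq_maxValue] at hlt hK
    have h4 : P.Phi N Λ K' + ℓ * ‖K' - K‖ ^ 2 ≤ a + 1 := by
      simp only [ne_eq, OfNat.ofNat_ne_zero, not_false_eq_true, zero_pow, mul_zero, add_zero] at h1
      linarith
    have h5 : K' ∈ C := hmem K' hK' (by nlinarith [sq_nonneg ‖K' - K‖])
    refine Metric.mem_cthickening_of_dist_le K K' δ C h5 ?_
    rw [dist_eq_norm, norm_sub_rev]
    refine abs_le_of_sq_le_sq' ?_ hδ.le |>.2
    have h6 : ℓ * ‖K' - K‖ ^ 2 ≤ ℓ * δ ^ 2 := by linarith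
    exact le_of_mul_le_mul_left h6 hℓ
  have hne : (P.sublevel N Λ ℓ K₀).Nonempty := ⟨K₀, le_refl (P.envelope N Λ ℓ K₀)⟩
  -- Smoothness constants may be enlarged from M to ℓ, so the supremum is exactly the ℓ that defines
  -- the set.
  refine ⟨M, ρ, hρ, fun K hK => hδS (hG K hK), fun _ => M, fun _ => ℓ, fun _ => ρ, fun _ => ρ,
    fun K hK => ⟨hM, hℓ, hρ, hρ, fun l hl K' hK' => ⟨fun h => ?_, fun h => ?_⟩⟩, ?_, ?_, ?_⟩
  · exact (hlip K (hG K hK) K' (hG K' hK') h l hl).1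
  · exact ((hlip K (hG K hK) K' (hG K' hK') h l hl).2).trans (by gcongr)
  · rw [hne.image_const]; exact isLUB_singleton
  · rw [hne.image_const]; exact isLUB_singleton
  · simp only [min_self]
    rw [hne.image_const]; exact isGLB_singleton

omit [IsProbabilityMeasure ℙ] in
theorem IsConstants.pos {P : ConstrainedLQR n m ι} {N : NoiseModel n ℙ} {Λ : ℝ} {K₀ : Gain E}
    {L₀ ℓ₀ ρ₀ : ℝ} (h : P.IsConstants N Λ K₀ L₀ ℓ₀ ρ₀) : 0 < L₀ ∧ 0 < ℓ₀ := by
  obtain ⟨-, Lip, smo, ψ, β, hK, hL, hℓ, -⟩ := h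
  have hm : K₀ ∈ P.sublevel N Λ ℓ₀ K₀ := le_refl (P.envelope N Λ ℓ₀ K₀)
  obtain ⟨h1, h2, -⟩ := hK K₀ hm
  exact ⟨h1.trans_le (hL.1 ⟨K₀, hm, rfl⟩), h2.trans_le (hℓ.1 ⟨K₀, hm, rfl⟩)⟩

theorem IsConstants.smoothOnSublevel {P : ConstrainedLQR n m ι} {N : NoiseModel n ℙ} {Λ : ℝ}
    (hΛ : 0 ≤ Λ) {K₀ : Gain E} {L₀ ℓ₀ ρ₀ : ℝ} (h : P.IsConstants N Λ K₀ L₀ ℓ₀ ρ₀) (hρ : 0 < ρ₀) :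
    SmoothOnSublevel (P.objective N) (fun i K => P.constraint N i K - P.c i) (multiplierBox ι Λ)
      {K | P.Stabilizing K} (P.sublevel N Λ ℓ₀ K₀) ℓ₀ ρ₀ where
  isOpen := P.isOpen_stabilizing
  isCompact := isCompact_multiplierBox
  nonempty := ⟨0, zero_mem_multiplierBox hΛ⟩
  convex := convex_multiplierBox
  nonneg := P.maxValue_nonneg N hΛ
  diff₀ K hK := (P.contDiffAt_objective N hK).differentiableAt (by norm_num)
  diff K hK i := ((P.contDiffAt_constraint N i hK).differentiableAt (by norm_num)).sub_const _
  pos := h.pos.2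
  radius_pos := hρ
  subset := h.1
  lower K hK K' hle := by
    rw [← envelope_eq] at hle
    exact hle.trans hK
  smooth K hK K' hK' l hl hd := by
    obtain ⟨-, Lip, smo, ψ, β, hc, -, hℓ, hg⟩ := h
    obtain ⟨-, -, -, -, hall⟩ := hc K hK
    refine ((hall l hl K' hK').2 (hd.trans ?_)).trans ?_
    · exact (hg.1 ⟨K, hK, rfl⟩).trans (min_le_left _ _)
    · gcongr
      exact hℓ.1 ⟨K, hK, rfl⟩

/-- A gradient step at a point of the sublevel set that is not `ε`-stationary decreases the
envelope, and the gradient of the maximizing Lagrangian controls that of the envelope. -/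
theorem IsConstants.step {P : ConstrainedLQR n m ι} {N : NoiseModel n ℙ} {Λ : ℝ}
    (hΛ : 0 ≤ Λ) {K₀ : Gain E} {L₀ ℓ₀ ρ₀ : ℝ} (h : P.IsConstants N Λ K₀ L₀ ℓ₀ ρ₀)
    {ε η : ℝ} (hε : 0 < ε) (hη : 0 < η) (hηle : η ≤ min (ε ^ 2 / (4 * ℓ₀ * L₀ ^ 2)) ρ₀)
    {K : Gain E} (hK : K ∈ P.sublevel N Λ ℓ₀ K₀) (hgt : ε < ‖gradient (P.envelope N Λ ℓ₀) K‖)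
    {l : EuclideanSpace ℝ ι} (hl : l ∈ multiplierBox ι Λ)
    (hmax : IsMaxOn (P.lagrangian N K) (multiplierBox ι Λ) l) :
    P.envelope N Λ ℓ₀ (K - η • P.gradK N K l) ≤ P.envelope N Λ ℓ₀ K - η * ε ^ 2 / 4 ∧
      ‖gradient (P.envelope N Λ ℓ₀) K‖ ≤ 2 * ‖P.gradK N K l‖ := by
  obtain ⟨hL0, hℓ0⟩ := h.pos
  have hρ : 0 < ρ₀ := hη.trans_le (hηle.trans (min_le_right _ _))
  have H := h.smoothOnSublevel hΛ hρ
  obtain ⟨p, hp⟩ := H.exists_prox hK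
  have hgrad : ‖gradient (P.envelope N Λ ℓ₀) K‖ = 2 * ℓ₀ * ‖K - p‖ := by
    rw [envelope_eq, (H.hasGradientAt_envelope hK hp).gradient, norm_smul,
      Real.norm_of_nonneg (by positivity)]
  rw [hgrad] at hgt ⊢
  have hd : 0 < ‖K - p‖ := by
    by_contra hcon
    have : ‖K - p‖ = 0 := le_antisymm (not_lt.1 hcon) (norm_nonneg _)
    rw [this] at hgt
    linarith
  have hne : K ≠ p := sub_ne_zero.1 (norm_pos_iff.1 hd)
  have hv : ‖P.gradK N K l‖ ≤ L₀ := by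
    obtain ⟨-, Lip, smo, ψ, β, hc, hL, -, -⟩ := h
    obtain ⟨-, -, hψ, -, hall⟩ := hc K hK
    exact (H.norm_gradient_le hK hp hne hl hmax hψ fun K' hK' hd' =>
      (hall l hl K' hK').1 hd').trans (hL.1 ⟨K, hK, rfl⟩)
  have hin := H.le_inner_gradient hK hp hl hmax
  have hstep := H.envelope_step_le hK hp hl hmax hη.le hv
  constructor
  · rw [← envelope_eq] at hstep
    refine hstep.trans ?_
    have h1 := hηle.trans (min_le_left _ _)
    rw [le_div_iff₀ (by positivity)] at h1
    -- The gain 2ℓ₀²η‖K - p‖² is half of η‖∇Φ_{μ₀}‖², so at least ηε²/2; the stepsize limits the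
    -- loss to ηε²/4.
    have h2 : ε ^ 2 ≤ (2 * ℓ₀ * ‖K - p‖) ^ 2 := by gcongr
    have h3 : η * (η * (4 * ℓ₀ * L₀ ^ 2)) ≤ η * ε ^ 2 := by gcongr
    have h4 : η * ε ^ 2 ≤ η * (2 * ℓ₀ * ‖K - p‖) ^ 2 := by gcongr
    nlinarith
  · have h1 : ℓ₀ * ‖K - p‖ ^ 2 ≤ ‖P.gradK N K l‖ * ‖K - p‖ := hin.trans (real_inner_le_norm _ _)
    have h2 : ℓ₀ * ‖K - p‖ ≤ ‖P.gradK N K l‖ := le_of_mul_le_mul_right (by linarith) hd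
    linarith

/-- The Danskin multiplier at the proximal point has exactly the gradient of the envelope, and as a
maximizer of a linear function over the box it makes the projection residual zero. -/
theorem IsConstants.exists_isDualStationary {P : ConstrainedLQR n m ι} {N : NoiseModel n ℙ} {Λ : ℝ}
    (hΛ : 0 ≤ Λ) {K₀ : Gain E} {L₀ ℓ₀ ρ₀ : ℝ} (h : P.IsConstants N Λ K₀ L₀ ℓ₀ ρ₀) (hρ : 0 < ρ₀)
    {ε : ℝ} (hε : 0 < ε) {K : Gain E} (hK : K ∈ P.sublevel N Λ ℓ₀ K₀)
    (hle : ‖gradient (P.envelope N Λ ℓ₀) K‖ ≤ ε) :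
    ∃ (K' : Gain E) (l' : EuclideanSpace ℝ ι),
      P.IsProx N Λ ℓ₀ K K' ∧ P.IsDualStationary N Λ ℓ₀ ε K' l' := by
  have hℓ0 := h.pos.2
  have H := h.smoothOnSublevel hΛ hρ
  obtain ⟨p, hp⟩ := H.exists_prox hK
  obtain ⟨l, hl, hmax, hgl⟩ := H.exists_isMaxOn_gradient_eq hp
  refine ⟨p, l, ⟨hp.1, by rw [envelope_eq]; exact hp.2⟩, hp.1, hl, ?_, ?_⟩
  · rw [envelope_eq, (H.hasGradientAt_envelope hK hp).gradient, ← hgl] at hle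
    exact hle
  · rw [P.gradMultiplier_eq, projBox_add_smul_eq (by positivity) hl, sub_self, norm_zero]
    · positivity
    · intro l' hl'
      have : affineLagrangian (P.objective N) (fun i K => P.constraint N i K - P.c i) p l' ≤
        affineLagrangian (P.objective N) (fun i K => P.constraint N i K - P.c i) p l := hmax hl'
      simpa [affineLagrangian] using this

end ConstrainedLQR

end

/-! ### Main theorem: counting the steps -/

theorem theorem1 {n m : ℕ} {ι : Type*} [Fintype ι] {Ω : Type*} [MeasurableSpace Ω]
    (ℙ : Measure Ω) [IsProbabilityMeasure ℙ] (E : Finset (Fin m × Fin n))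
    (P : ConstrainedLQR n m ι) (N : NoiseModel n ℙ) (Λ : ℝ) (hΛ : 0 ≤ Λ)
    (K₀ : Gain E) (hK₀ : P.Stabilizing K₀) :
    -- the limits that define the costs exist, and the Lagrangian is differentiable
    (∀ K : Gain E, P.Stabilizing K →
      Tendsto (P.runningCost N P.Q P.R 0 K) atTop (𝓝 (P.objective N K)) ∧
      (∀ i, Tendsto (P.runningCost N (P.Qc i) (P.Rc i) (P.qc i) K) atTop
        (𝓝 (P.constraint N i K))) ∧
      (∀ l, DifferentiableAt ℝ (fun K' : Gain E => P.lagrangian N K' l) K)) ∧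
    -- the constants over the sublevel set can be found, by taking `ℓ₀` large enough
    (P.Q.PosDef → P.R.PosDef → N.W.PosDef →
      ∀ᶠ ℓ₀ in atTop, ∃ L₀ ρ₀ : ℝ, 0 < ρ₀ ∧ P.IsConstants N Λ K₀ L₀ ℓ₀ ρ₀) ∧
    -- convergence
    (∀ L₀ ℓ₀ ρ₀ : ℝ, P.IsConstants N Λ K₀ L₀ ℓ₀ ρ₀ →
      ∀ ε η : ℝ, 0 < ε → 0 < η → η ≤ min (ε ^ 2 / (4 * ℓ₀ * L₀ ^ 2)) ρ₀ →
      ∀ (K : ℕ → Gain E) (l : ℕ → EuclideanSpace ℝ ι), P.IsGDmaxRun N Λ ℓ₀ η ε K₀ K l →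
      ∃ J : ℕ,
        -- an `ε`-stationary point of `Φ` is reached at iteration `J`
        ‖gradient (P.envelope N Λ ℓ₀) (K J)‖ ≤ ε ∧
        -- the number of iterations
        (J : ℝ) ≤ 4 * P.envelope N Λ ℓ₀ K₀ / (η * ε ^ 2) ∧
        (η = ε ^ 2 / (4 * ℓ₀ * L₀ ^ 2) →
          (J : ℝ) ≤ 16 * (ℓ₀ * L₀ ^ 2 * P.envelope N Λ ℓ₀ K₀ / ε ^ 4)) ∧
        -- the iterates stay in the sublevel set, and the envelope does not increase
        (∀ j ≤ J, K j ∈ P.sublevel N Λ ℓ₀ K₀ ∧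
          DifferentiableAt ℝ (P.envelope N Λ ℓ₀) (K j)) ∧
        (∀ j < J, P.envelope N Λ ℓ₀ (K (j + 1)) ≤ P.envelope N Λ ℓ₀ (K j)) ∧
        -- what the computable test on the gradient of the Lagrangian guarantees
        (∀ j ≤ J, ‖P.gradK N (K j) (l j)‖ ≤ ε →
          ‖gradient (P.envelope N Λ ℓ₀) (K j)‖ ≤ 2 * ε) ∧
        -- the point reached yields an `ε`-stationary point for the dual problem
        ∃ (K' : Gain E) (l' : EuclideanSpace ℝ ι),
          P.IsProx N Λ ℓ₀ (K J) K' ∧ P.IsDualStationary N Λ ℓ₀ ε K' l') := by 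
  refine ⟨fun K hK => ⟨?_, fun i => ?_, P.differentiableAt_lagrangian N hK⟩,
    P.eventually_exists_isConstants N hΛ hK₀, ?_⟩
  · rw [P.objective_eq N hK]
    exact P.tendsto_runningCost N P.Q P.R 0 hK
  · rw [P.constraint_eq N i hK]
    exact P.tendsto_runningCost N (P.Qc i) (P.Rc i) (P.qc i) hK
  intro L₀ ℓ₀ ρ₀ hc ε η hε hη hηle K l hrun
  obtain ⟨hL0, hℓ0⟩ := hc.pos
  have hρ : 0 < ρ₀ := hη.trans_le (hηle.trans (min_le_right _ _))
  have H := hc.smoothOnSublevel hΛ hρ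
  have hpos : 0 < η * ε ^ 2 := by positivity
  -- the iterates as long as no stationary point has been reached
  have main : ∀ j, (∀ i < j, ε < ‖gradient (P.envelope N Λ ℓ₀) (K i)‖) →
      K j ∈ P.sublevel N Λ ℓ₀ K₀ ∧
        P.envelope N Λ ℓ₀ (K j) ≤ P.envelope N Λ ℓ₀ K₀ - j * (η * ε ^ 2 / 4) := by
    intro j
    induction j with
    | zero => intro _; rw [hrun.init]; simp [ConstrainedLQR.sublevel]
    | succ j ih =>
      intro hj
      obtain ⟨h1, h2⟩ := ih fun i hi => hj i (hi.trans (Nat.lt_succ_self j))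
      have hj' : ∀ i ≤ j, ε < ‖gradient (P.envelope N Λ ℓ₀) (K i)‖ := fun i hi =>
        hj i (Nat.lt_succ_of_le hi)
      obtain ⟨hl, hmax⟩ := hrun.oracle j hj'
      have h3 := (hc.step hΛ hε hη hηle h1 (hj' j le_rfl) hl hmax).1
      rw [← hrun.update j hj'] at h3
      have h4 : P.envelope N Λ ℓ₀ (K j) ≤ P.envelope N Λ ℓ₀ K₀ := h1
      refine ⟨?_, ?_⟩
      · change P.envelope N Λ ℓ₀ (K (j + 1)) ≤ P.envelope N Λ ℓ₀ K₀
        linarith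
      · push_cast
        linarith
  have hnonneg : ∀ K' : Gain E, 0 ≤ P.envelope N Λ ℓ₀ K' := fun K' => by
    rw [P.envelope_eq]
    exact moreauEnvelope_nonneg ⟨K₀, hK₀⟩ H.nonneg hℓ0 K'
  have hbound : ∀ j : ℕ, (∀ i < j, ε < ‖gradient (P.envelope N Λ ℓ₀) (K i)‖) →
      (j : ℝ) ≤ 4 * P.envelope N Λ ℓ₀ K₀ / (η * ε ^ 2) := by
    intro j hj
    have h1 := (main j hj).2
    have h2 := hnonneg (K j)
    rw [le_div_iff₀ hpos]
    linarith
  have hex : ∃ J, ‖gradient (P.envelope N Λ ℓ₀) (K J)‖ ≤ ε := by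
    by_contra! hcon
    obtain ⟨j, hj⟩ := exists_nat_gt (4 * P.envelope N Λ ℓ₀ K₀ / (η * ε ^ 2))
    exact absurd (hbound j fun i _ => hcon i) (not_le.2 hj)
  classical
  -- J is the first stationary index, so the oracle and the update rule are available at every
  -- earlier step.
  have hJ := Nat.find_spec hex
  have hlt : ∀ i < Nat.find hex, ε < ‖gradient (P.envelope N Λ ℓ₀) (K i)‖ := fun i hi =>
    not_le.1 (Nat.find_min hex hi)
  set J := Nat.find hex
  have hmem : ∀ j ≤ J, K j ∈ P.sublevel N Λ ℓ₀ K₀ := fun j hj =>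
    (main j fun i hi => hlt i (hi.trans_le hj)).1
  have hstep : ∀ j < J, P.envelope N Λ ℓ₀ (K (j + 1)) ≤ P.envelope N Λ ℓ₀ (K j) ∧
      ‖gradient (P.envelope N Λ ℓ₀) (K j)‖ ≤ 2 * ‖P.gradK N (K j) (l j)‖ := by
    intro j hj
    have hj' : ∀ i ≤ j, ε < ‖gradient (P.envelope N Λ ℓ₀) (K i)‖ := fun i hi =>
      hlt i (hi.trans_lt hj)
    obtain ⟨hl, hmax⟩ := hrun.oracle j hj'
    obtain ⟨h1, h2⟩ := hc.step hΛ hε hη hηle (hmem j hj.le) (hj' j le_rfl) hl hmax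
    rw [← hrun.update j hj'] at h1
    exact ⟨by linarith, h2⟩
  refine ⟨J, hJ, hbound J hlt, fun hηeq => ?_, fun j hj => ⟨hmem j hj, ?_⟩,
    fun j hj => (hstep j hj).1, fun j hj hv => ?_, hc.exists_isDualStationary hΛ hρ hε
      (hmem J le_rfl) hJ⟩
  · refine (hbound J hlt).trans (le_of_eq ?_)
    rw [hηeq]
    field_simp
    ring
  · obtain ⟨p, hp⟩ := H.exists_prox (hmem j hj)
    rw [P.envelope_eq]
    exact (H.hasGradientAt_envelope (hmem j hj) hp).differentiableAt
  · rcases hj.lt_or_eq with hj | rfl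
    · exact (hstep j hj).2.trans (by linarith)
    -- At J itself the multiplier is arbitrary, but the gradient of the envelope is already at most
    -- ε.
    · linarith
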